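/- Let $d\ge 0$ be an integer, let $Y_1,\dots,Y_d$ be a basis of $\mathbb R^d$ generating the lattice $\mathcal R$, and let $\mathcal V\subset\mathbb R^d$ be a unit cell, i.e. a set whose translates by $\mathcal R$ tile $\mathbb R^d$ up to null sets. Write $\langle f\rangle=\frac1{|\mathcal V|}\int_{\mathcal V}f\,dx$ and $s:e=\sum_{i,j}s_{ij}e_{ij}$. Let $L^2_{\rm per}(\mathcal V)$ be the space of $\mathcal R$-periodic real functions in $L^2_{\rm loc}(\mathbb R^d)$ (up to a.e. equality), and let $H^1_{\rm per}(\mathcal V)$ be the space of $f\in L^2_{\rm per}(\mathcal V)$ whose distributional derivatives $\partial_jf$, $1\le j\le d$, lie in $L^2_{\rm per}(\mathcal V)$. Let $L_0$ be a constant fourth-order tensor with minor and major symmetries ($L_{ijkl}=L_{jikl}=L_{ijlk}=L_{klij}$) that is positive definite on symmetric second-order tensors, acting by $(L_0\eta)_{ij}=\sum_{k,l}L_{ijkl}\eta_{kl}$. Let $H_e$ be the space of symmetric second-order tensor fields with components in $L^2_{\rm per}(\mathcal V)$, with the energetic scalar product $(\eta,\tilde\eta)_e=\langle L_0\eta:\tilde\eta\rangle$,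 and let $$E_0=\{e\in H_e:\ e=\tfrac12(\nabla w+\nabla w^{\top})\ \text{for some}\ w\in H^1_{\rm per}(\mathcal V)^d\}.$$ Let $H_s$ be the space of symmetric $L^2_{\rm per}(\mathcal V)$ tensor fields regarded as stress fields, $U_s\subset H_s$ the constant fields, $S_0\subset H_s$ the fields $s$ with $\langle s\rangle=0$ and $\operatorname{div}s=0$ in the sense of distributions on $\mathbb R^d$ (that is, $\operatorname{div} s=0$ in the cell, with anti-periodic normal traces on its boundary), and $S=U_s\oplus S_0$. For $\tau\in H_s$ let $\Gamma_0\tau$ be the solution $e^*$ of the problem: find $e^*\in E_0$ such that $L_0e^*-\tau\in S$. Then $H_e$ is a Hilbert space, this problem has exactly one solution for every $\tau\in H_s$ (so that $\Gamma_0:H_s\to H_e$ is well defined), and: 1. $\Gamma_0L_0$ is idempotent: $\Gamma_0L_0\Gamma_0L_0=\Gamma_0L_0$ on $H_e$. 2. $\Gamma_0L_0$ is self-adjoint: $(\eta,\Gamma_0L_0\tilde\eta)_e=(\Gamma_0L_0\eta,\tilde\eta)_e$ for all $\eta,\tilde\eta\in H_e$. 3. $\Gamma_0L_0\eta\in E_0$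 for all $\eta\in H_e$, and $\Gamma_0L_0e^*=e^*$ for all $e^*\in E_0$. Consequently every $\eta\in H_e$ has an orthogonal projection onto $E_0$ for $(\cdot,\cdot)_e$, and $\Gamma_0L_0\eta$ is that projection: $\Gamma_0L_0:H_e\to H_e$ is the orthogonal projector onto $E_0$. -/

import Mathlib

open MeasureTheory Set Filter
open scoped ENNReal ContDiff

noncomputable section

namespace PeriodicElasticity

/-- Physical space `ℝ^d`. -/
abbrev X (d : ℕ) : Type := EuclideanSpace ℝ (Fin d)

/-- A unit cell `V ⊆ ℝ^d` that fills space by translation along the lattice generated by the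
`d` linearly independent vectors `Y 0, …, Y (d-1)`: the translates of `V` by lattice vectors
cover `ℝ^d` and do not overlap, both up to null sets. -/
structure UnitCell (d : ℕ) where
  /-- the periods -/
  Y : Module.Basis (Fin d) ℝ (X d)
  /-- the cell -/
  V : Set (X d)
  tiles : IsAddFundamentalDomain (Submodule.span ℤ (range Y)).toAddSubgroup V (volume : Measure (X d))

/-- The lattice of periods of a unit cell. -/
abbrev UnitCell.lattice {d : ℕ} (C : UnitCell d) : AddSubgroup (X d) :=
  (Submodule.span ℤ (range C.Y)).toAddSubgroup

/-- A uniform fourth-order elastic stiffness tensor: minor and major symmetries, and positive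
definiteness on symmetric second-order tensors. -/
structure ElasticityTensor (d : ℕ) where
  coeff : Fin d → Fin d → Fin d → Fin d → ℝ
  minor_left : ∀ i j k l, coeff i j k l = coeff j i k l
  minor_right : ∀ i j k l, coeff i j k l = coeff i j l k
  major : ∀ i j k l, coeff i j k l = coeff k l i j
  pos : ∀ e : Fin d → Fin d → ℝ, (∀ i j, e i j = e j i) → e ≠ 0 →
    0 < ∑ i, ∑ j, (∑ k, ∑ l, coeff i j k l * e k l) * e i j

variable {d : ℕ}

instance (C : UnitCell d) : Countable C.lattice :=
  inferInstanceAs (Countable (Submodule.span ℤ (range C.Y)))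

lemma quasi_translate (y : X d) :
    Measure.QuasiMeasurePreserving (fun x : X d => x + y) volume volume :=
  (measurePreserving_add_right volume y).quasiMeasurePreserving

/-- The space `L²_per(V)` of (classes of) real functions in `L²_loc(ℝ^d)` that are periodic with
respect to the lattice of the unit cell. -/
def L2per (C : UnitCell d) : Submodule ℝ (X d →ₘ[(volume : Measure (X d))] ℝ) where
  carrier := {f | (∀ K : Set (X d), IsCompact K → MemLp f 2 (volume.restrict K)) ∧
    ∀ y ∈ C.lattice, (fun x => f (x + y)) =ᵐ[volume] f}
  add_mem' := by
    rintro f g ⟨hf, hf'⟩ ⟨hg, hg'⟩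
    refine ⟨fun K hK => ?_, fun y hy => ?_⟩
    · exact ((hf K hK).add (hg K hK)).ae_eq (ae_restrict_of_ae (AEEqFun.coeFn_add f g).symm)
    · filter_upwards [hf' y hy, hg' y hy, AEEqFun.coeFn_add f g,
        (quasi_translate y).ae (AEEqFun.coeFn_add f g)] with x h1 h2 h3 h4
      rw [h3, h4, Pi.add_apply, Pi.add_apply, h1, h2]
  zero_mem' := by
    refine ⟨fun K hK => ?_, fun y hy => ?_⟩
    · exact (MemLp.zero (μ := volume.restrict K) (p := 2) (ε := ℝ)).ae_eq
        (ae_restrict_of_ae (AEEqFun.coeFn_zero (μ := (volume : Measure (X d))) (β := ℝ)).symm)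
    · filter_upwards [AEEqFun.coeFn_zero (μ := (volume : Measure (X d))) (β := ℝ),
        (quasi_translate y).ae
          (AEEqFun.coeFn_zero (μ := (volume : Measure (X d))) (β := ℝ))] with x h1 h2
      rw [h1, h2, Pi.zero_apply, Pi.zero_apply]
  smul_mem' := by
    rintro c f ⟨hf, hf'⟩
    refine ⟨fun K hK => ?_, fun y hy => ?_⟩
    · exact ((hf K hK).const_smul c).ae_eq (ae_restrict_of_ae (AEEqFun.coeFn_smul c f).symm)
    · filter_upwards [hf' y hy, AEEqFun.coeFn_smul c f,
        (quasi_translate y).ae (AEEqFun.coeFn_smul c f)] with x h1 h3 h4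
      rw [h3, h4, Pi.smul_apply, Pi.smul_apply, h1]

variable {C : UnitCell d}

/-- A representative function of an element of `L²_per(V)`. -/
def fn (f : L2per C) : X d → ℝ := ⇑(f : X d →ₘ[(volume : Measure (X d))] ℝ)

lemma fn_add (f g : L2per C) : fn (f + g) =ᵐ[volume] fun x => fn f x + fn g x :=
  AEEqFun.coeFn_add f.1 g.1

lemma fn_smul (c : ℝ) (f : L2per C) : fn (c • f) =ᵐ[volume] fun x => c * fn f x :=
  AEEqFun.coeFn_smul c f.1

lemma fn_zero : fn (0 : L2per C) =ᵐ[volume] fun _ => (0 : ℝ) :=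
  AEEqFun.coeFn_zero

lemma aesm (f : L2per C) : AEStronglyMeasurable (fn f) volume :=
  f.1.aestronglyMeasurable

lemma ext_ae {f g : L2per C} (h : (fn f) =ᵐ[volume] (fn g)) : f = g :=
  Subtype.ext (AEEqFun.ext h)

lemma fn_vadd (f : L2per C) (y : C.lattice) :
    (fun x => fn f (y +ᵥ x)) =ᵐ[volume] (fn f) := by
  filter_upwards [f.2.2 y y.2] with x hx
  rw [AddSubgroup.vadd_def, vadd_eq_add, add_comm]
  exact hx

lemma locallyIntegrable (f : L2per C) : LocallyIntegrable (fn f) volume := by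
  rw [locallyIntegrable_iff]
  intro K hK
  have : IsFiniteMeasure (volume.restrict K) := ⟨by simpa using (hK.measure_lt_top (μ := (volume : Measure (X d))))⟩
  exact (f.2.1 K hK).integrable (by norm_num)

/-- Integrals of a.e. periodic functions do not depend on the fundamental domain. -/
lemma setLIntegral_periodic {s t : Set (X d)} {F : X d → ℝ≥0∞}
    (hs : IsAddFundamentalDomain C.lattice s (volume : Measure (X d)))
    (ht : IsAddFundamentalDomain C.lattice t (volume : Measure (X d)))
    (hF : ∀ y : C.lattice, (fun x => F (y +ᵥ x)) =ᵐ[volume] F) :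
    ∫⁻ x in s, F x = ∫⁻ x in t, F x := by
  rw [ht.setLIntegral_eq_tsum F s, hs.setLIntegral_eq_tsum' F t]
  refine tsum_congr fun g => ?_
  rw [inter_comm]
  exact (lintegral_congr_ae (ae_restrict_of_ae (hF (-g)))).symm

lemma memLp_cell (f : L2per C) : MemLp (fn f) 2 (volume.restrict C.V) := by
  refine ⟨(aesm f).restrict, ?_⟩
  have hP := ZSpan.isAddFundamentalDomain' C.Y (volume : Measure (X d))
  have h1 : MemLp (fn f) 2 (volume.restrict (ZSpan.fundamentalDomain C.Y)) :=
    (f.2.1 _ (ZSpan.fundamentalDomain_isBounded C.Y).isCompact_closure).mono_measure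
      (Measure.restrict_mono subset_closure le_rfl)
  have h2 := h1.2
  rw [eLpNorm_lt_top_iff_lintegral_rpow_enorm_lt_top (by norm_num) (by norm_num)] at h2 ⊢
  rwa [setLIntegral_periodic C.tiles hP]
  intro y
  filter_upwards [fn_vadd f y] with x hx
  rw [hx]

lemma integrable_mul_cell (f g : L2per C) :
    Integrable (fun x => fn f x * fn g x) (volume.restrict C.V) :=
  (memLp_cell f).integrable_mul (memLp_cell g)

lemma UnitCell.volume_ne_zero (C : UnitCell d) : volume C.V ≠ 0 :=
  C.tiles.measure_ne_zero (NeZero.ne _)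

lemma UnitCell.volume_ne_top (C : UnitCell d) : volume C.V ≠ ⊤ := by
  rw [C.tiles.measure_eq (ZSpan.isAddFundamentalDomain' C.Y (volume : Measure (X d)))]
  exact (ZSpan.fundamentalDomain_isBounded C.Y).measure_lt_top.ne

lemma eq_zero_of_ae (f : L2per C) (h : ∀ᵐ x ∂(volume.restrict C.V), fn f x = 0) :
    f = 0 := by
  refine ext_ae (EventuallyEq.trans ?_ fn_zero.symm)
  have h1 : ∫⁻ x, ‖fn f x‖ₑ = 0 := by
    rw [C.tiles.lintegral_eq_tsum'', ENNReal.tsum_eq_zero]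
    intro y
    rw [lintegral_eq_zero_iff' (by
      have := (aesm f).enorm.comp_quasiMeasurePreserving
        (measurePreserving_vadd y (volume : Measure (X d))).quasiMeasurePreserving
      exact this.restrict)]
    filter_upwards [h, ae_restrict_of_ae (fn_vadd f y)] with x hx hx'
    simp [hx', hx]
  rw [lintegral_eq_zero_iff' (aesm f).enorm] at h1
  filter_upwards [h1] with x hx
  simpa using hx

/-- The average `⟨f⟩` over the unit cell. -/
def cellAverage (C : UnitCell d) (f : X d → ℝ) : ℝ := ⨍ x in C.V, f x

/-- Symmetric second-order tensor fields with components in `L²_per(V)`. -/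
def SymL2per (C : UnitCell d) : Submodule ℝ (Fin d → Fin d → L2per C) where
  carrier := {F | ∀ i j, F i j = F j i}
  add_mem' := fun hF hG i j => by simp [hF i j, hG i j]
  zero_mem' := fun i j => rfl
  smul_mem' := fun c F hF i j => by simp [hF i j]

/-- The value at `x` of the `(i, j)` component of a tensor field. -/
def comp (η : SymL2per C) (i j : Fin d) (x : X d) : ℝ := fn (η.1 i j) x

/-- Pointwise application of a uniform elasticity tensor to a tensor field:
`(L η)_{ij} = ∑_{k,l} L_{ijkl} η_{kl}`. -/
def ElasticityTensor.apply (L : ElasticityTensor d) : SymL2per C →ₗ[ℝ] SymL2per C where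
  toFun η := ⟨fun i j => ∑ k, ∑ l, L.coeff i j k l • η.1 k l, fun i j => by
    simp only [L.minor_left i j]⟩
  map_add' η ζ := by
    ext1
    funext i j
    simp [Finset.sum_add_distrib]
  map_smul' c η := by
    ext1
    funext i j
    simp [Finset.smul_sum, smul_comm c]

/-- The duality product `⟨τ : η⟩` between stress and strain fields. -/
def duality (τ η : SymL2per C) : ℝ :=
  cellAverage C fun x => ∑ i, ∑ j, comp τ i j x * comp η i j x

/-- The bilinear form `⟨f g⟩` on scalar periodic fields. -/
def avgMul : L2per C →ₗ[ℝ] L2per C →ₗ[ℝ] ℝ :=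
  LinearMap.mk₂ ℝ (fun f g => cellAverage C fun x => fn f x * fn g x)
    (fun f f' g => by
      simp only [cellAverage, setAverage_eq]
      rw [← smul_add, ← integral_add (integrable_mul_cell f g) (integrable_mul_cell f' g)]
      congr 1
      refine integral_congr_ae (ae_restrict_of_ae ?_)
      filter_upwards [fn_add f f'] with x hx
      rw [hx, add_mul])
    (fun c f g => by
      have h : ∫ x in C.V, fn (c • f) x * fn g x = c * ∫ x in C.V, fn f x * fn g x := by
        rw [← integral_const_mul]
        refine integral_congr_ae (ae_restrict_of_ae ?_)
        filter_upwards [fn_smul c f] with x hx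
        simp only [hx, mul_assoc]
      simp only [cellAverage, setAverage_eq, h, smul_eq_mul, mul_left_comm])
    (fun f g g' => by
      simp only [cellAverage, setAverage_eq]
      rw [← smul_add, ← integral_add (integrable_mul_cell f g) (integrable_mul_cell f g')]
      congr 1
      refine integral_congr_ae (ae_restrict_of_ae ?_)
      filter_upwards [fn_add g g'] with x hx
      rw [hx, mul_add])
    (fun c f g => by
      have h : ∫ x in C.V, fn f x * fn (c • g) x = c * ∫ x in C.V, fn f x * fn g x := by
        rw [← integral_const_mul]
        refine integral_congr_ae (ae_restrict_of_ae ?_)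
        filter_upwards [fn_smul c g] with x hx
        simp only [hx, mul_left_comm]
      simp only [cellAverage, setAverage_eq, h, smul_eq_mul, mul_left_comm])

lemma avgMul_comm (f g : L2per C) : avgMul f g = avgMul g f := by
  simp only [avgMul, LinearMap.mk₂_apply, mul_comm]

lemma duality_eq_sum (τ η : SymL2per C) :
    duality τ η = ∑ i, ∑ j, avgMul (τ.1 i j) (η.1 i j) := by
  simp only [duality, cellAverage, setAverage_eq, comp, avgMul, LinearMap.mk₂_apply]
  rw [integral_finsetSum _ fun i _ => integrable_finsetSum _ fun j _ =>
    integrable_mul_cell (τ.1 i j) (η.1 i j), Finset.smul_sum]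
  refine Finset.sum_congr rfl fun i _ => ?_
  rw [integral_finsetSum _ fun j _ => integrable_mul_cell (τ.1 i j) (η.1 i j), Finset.smul_sum]

lemma fn_sum {ι : Type*} (s : Finset ι) (f : ι → L2per C) :
    fn (∑ i ∈ s, f i) =ᵐ[volume] fun x => ∑ i ∈ s, fn (f i) x := by
  classical
  induction s using Finset.induction_on with
  | empty => simpa using fn_zero (C := C)
  | insert a s ha ih =>
    rw [Finset.sum_insert ha]
    filter_upwards [fn_add (f a) (∑ i ∈ s, f i), ih] with x h1 h2
    rw [h1, h2, Finset.sum_insert ha]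

lemma comp_apply_ae (L : ElasticityTensor d) (η : SymL2per C) (i j : Fin d) :
    comp (L.apply η) i j =ᵐ[volume] fun x => ∑ k, ∑ l, L.coeff i j k l * comp η k l x := by
  have h1 : ∀ k, fn (∑ l, L.coeff i j k l • η.1 k l) =ᵐ[volume]
      fun x => ∑ l, L.coeff i j k l * comp η k l x := by
    intro k
    have h2 : ∀ᵐ x, ∀ l, fn (L.coeff i j k l • η.1 k l) x = L.coeff i j k l * comp η k l x :=
      ae_all_iff.2 fun l => fn_smul _ _
    filter_upwards [fn_sum Finset.univ fun l => L.coeff i j k l • η.1 k l, h2] with x h3 h4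
    simp only [h3, h4]
  have h5 : ∀ᵐ x, ∀ k, fn (∑ l, L.coeff i j k l • η.1 k l) x
      = ∑ l, L.coeff i j k l * comp η k l x := ae_all_iff.2 h1
  filter_upwards [fn_sum Finset.univ fun k => ∑ l, L.coeff i j k l • η.1 k l, h5] with x h6 h7
  refine Eq.trans h6 ?_
  simp only [h7]

/-- The energetic scalar product `⟨L η : ζ⟩`. -/
def energetic (L : ElasticityTensor d) (η ζ : SymL2per C) : ℝ := duality (L.apply η) ζ

lemma energetic_eq_sum (L : ElasticityTensor d) (η ζ : SymL2per C) :
    energetic L η ζ =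
      ∑ i, ∑ j, ∑ k, ∑ l, L.coeff i j k l * avgMul (η.1 k l) (ζ.1 i j) := by
  simp only [energetic, duality_eq_sum, ElasticityTensor.apply, LinearMap.coe_mk, AddHom.coe_mk,
    map_sum, map_smul, LinearMap.sum_apply, LinearMap.smul_apply, smul_eq_mul]

lemma energetic_comm (L : ElasticityTensor d) (η ζ : SymL2per C) :
    energetic L η ζ = energetic L ζ η := by
  simp only [energetic_eq_sum]
  have h : ∀ F : Fin d → Fin d → Fin d → Fin d → ℝ,
      ∑ i, ∑ j, ∑ k, ∑ l, F i j k l = ∑ i, ∑ j, ∑ k, ∑ l, F k l i j := by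
    intro F
    have h1 : ∀ G : Fin d → Fin d → Fin d → Fin d → ℝ, ∑ i, ∑ j, ∑ k, ∑ l, G i j k l =
        ∑ p : Fin d × Fin d, ∑ q : Fin d × Fin d, G p.1 p.2 q.1 q.2 := fun G => by
      simp only [Fintype.sum_prod_type]
    rw [h1, h1 fun i j k l => F k l i j, Finset.sum_comm]
  rw [h]
  refine Finset.sum_congr rfl fun i _ => Finset.sum_congr rfl fun j _ =>
    Finset.sum_congr rfl fun k _ => Finset.sum_congr rfl fun l _ => ?_
  rw [L.major, avgMul_comm]

/-- The elastic energy density `L e : e`. -/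
def ElasticityTensor.density (L : ElasticityTensor d) (e : Fin d → Fin d → ℝ) : ℝ :=
  ∑ i, ∑ j, (∑ k, ∑ l, L.coeff i j k l * e k l) * e i j

lemma density_nonneg (L : ElasticityTensor d) (e : Fin d → Fin d → ℝ)
    (he : ∀ i j, e i j = e j i) : 0 ≤ L.density e := by
  by_cases h : e = 0
  · simp [ElasticityTensor.density, h]
  · exact (L.pos e he h).le

lemma energetic_self (L : ElasticityTensor d) (η : SymL2per C) :
    energetic L η η = cellAverage C fun x => L.density fun i j => comp η i j x := by
  simp only [energetic, duality, cellAverage, setAverage_eq]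
  congr 1
  refine integral_congr_ae (ae_restrict_of_ae ?_)
  have h : ∀ᵐ x, ∀ i j, comp (L.apply η) i j x = ∑ k, ∑ l, L.coeff i j k l * comp η k l x :=
    ae_all_iff.2 fun i => ae_all_iff.2 fun j => comp_apply_ae L η i j
  filter_upwards [h] with x hx
  simp only [ElasticityTensor.density, hx]

lemma integrable_density (L : ElasticityTensor d) (η : SymL2per C) :
    Integrable (fun x => L.density fun i j => comp η i j x) (volume.restrict C.V) := by
  simp only [ElasticityTensor.density, Finset.sum_mul]
  refine integrable_finsetSum _ fun i _ => integrable_finsetSum _ fun j _ =>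
    integrable_finsetSum _ fun k _ => integrable_finsetSum _ fun l _ => ?_
  simp only [mul_assoc]
  exact (integrable_mul_cell (η.1 k l) (η.1 i j)).const_mul _

lemma comp_symm (η : SymL2per C) (i j : Fin d) (x : X d) : comp η i j x = comp η j i x := by
  rw [comp, comp, η.2 i j]

lemma energetic_self_nonneg (L : ElasticityTensor d) (η : SymL2per C) :
    0 ≤ energetic L η η := by
  rw [energetic_self, cellAverage, setAverage_eq]
  exact smul_nonneg (by positivity)
    (integral_nonneg fun x => density_nonneg L _ fun i j => comp_symm η i j x)

lemma energetic_definite (L : ElasticityTensor d) (η : SymL2per C) (h : energetic L η η = 0) :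
    η = 0 := by
  rw [energetic_self, cellAverage, setAverage_eq, smul_eq_zero] at h
  have hV : (volume.real C.V)⁻¹ ≠ 0 :=
    inv_ne_zero (ENNReal.toReal_ne_zero.2 ⟨C.volume_ne_zero, C.volume_ne_top⟩)
  have h1 := h.resolve_left hV
  rw [integral_eq_zero_iff_of_nonneg
    (fun x => density_nonneg L _ fun i j => comp_symm η i j x) (integrable_density L η)] at h1
  have h2 : ∀ᵐ x ∂(volume.restrict C.V), ∀ i j, comp η i j x = 0 := by
    filter_upwards [h1] with x hx
    by_contra hne
    have h3 : (fun i j => comp η i j x) ≠ 0 := fun h0 => hne fun i j => congrFun (congrFun h0 i) j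
    exact (L.pos _ (fun i j => comp_symm η i j x) h3).ne' hx
  ext1
  funext i j
  exact eq_zero_of_ae _ (h2.mono fun x hx => hx i j)

/-- The space `H_e` of strain fields: symmetric `L²_per(V)` tensor fields, equipped (below) with
the energetic scalar product of the reference stiffness tensor `L`. -/
def He (C : UnitCell d) (_L : ElasticityTensor d) : Type := SymL2per C

instance (L : ElasticityTensor d) : AddCommGroup (He C L) :=
  inferInstanceAs (AddCommGroup (SymL2per C))

instance (L : ElasticityTensor d) : Module ℝ (He C L) :=
  inferInstanceAs (Module ℝ (SymL2per C))

/-- The tensor field underlying an element of `H_e`. -/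
def He.field {L : ElasticityTensor d} : He C L ≃ₗ[ℝ] SymL2per C := LinearEquiv.refl ℝ _

instance heCore (L : ElasticityTensor d) : InnerProductSpace.Core ℝ (He C L) where
  inner η ζ := energetic L η.field ζ.field
  conj_inner_symm η ζ := energetic_comm L _ _
  re_inner_nonneg η := energetic_self_nonneg L _
  add_left η ζ ξ := by
    simp only [map_add, energetic, duality_eq_sum, Submodule.coe_add, Pi.add_apply,
      LinearMap.add_apply, Finset.sum_add_distrib]
  smul_left η ζ c := by
    simp only [map_smul, energetic, duality_eq_sum, Submodule.coe_smul, Pi.smul_apply,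
      LinearMap.smul_apply, smul_eq_mul, Finset.mul_sum, conj_trivial]
  definite η h := energetic_definite L _ h

instance (L : ElasticityTensor d) : NormedAddCommGroup (He C L) :=
  (heCore L).toNormedAddCommGroup

instance (L : ElasticityTensor d) : InnerProductSpace ℝ (He C L) :=
  InnerProductSpace.ofCore (heCore L).toCore

lemma inner_eq_energetic (L : ElasticityTensor d) (η ζ : He C L) :
    inner ℝ η ζ = energetic L η.field ζ.field := rfl

/-- The space `H_s` of stress fields, the dual of `H_e` being identified with symmetric
`L²_per(V)` tensor fields through the duality product `⟨τ : η⟩`. -/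
abbrev Hs (C : UnitCell d) : Type := SymL2per C

/-- The reference stiffness as a map `H_e → H_s`, `η ↦ L η`. -/
def stiffness (L : ElasticityTensor d) : He C L →ₗ[ℝ] Hs C := L.apply ∘ₗ He.field.toLinearMap

/-- Scalar test functions: smooth with compact support in `ℝ^d`. -/
def IsTest (φ : X d → ℝ) : Prop := ContDiff ℝ ∞ φ ∧ HasCompactSupport φ

/-- The classical partial derivative `∂_j φ (x)`. -/
def pderiv (j : Fin d) (φ : X d → ℝ) (x : X d) : ℝ :=
  fderiv ℝ φ x (EuclideanSpace.single j 1)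

lemma integrable_mul_test (f : L2per C) {φ : X d → ℝ} (hφ : IsTest φ) :
    Integrable (fun x => fn f x * φ x) :=
  (locallyIntegrable f).integrable_smul_right_of_hasCompactSupport hφ.1.continuous hφ.2

lemma integrable_mul_pderiv (f : L2per C) {φ : X d → ℝ} (hφ : IsTest φ) (j : Fin d) :
    Integrable (fun x => fn f x * pderiv j φ x) := by
  refine (locallyIntegrable f).integrable_smul_right_of_hasCompactSupport
    (g := pderiv j φ) ?_ ?_
  · exact (hφ.1.continuous_fderiv (by simp)).clm_apply continuous_const
  · exact hφ.2.fderiv_apply (𝕜 := ℝ) (EuclideanSpace.single j 1)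

lemma integral_add_mul {f g : L2per C} {ψ : X d → ℝ} (hf : Integrable fun x => fn f x * ψ x)
    (hg : Integrable fun x => fn g x * ψ x) :
    ∫ x, fn (f + g) x * ψ x = (∫ x, fn f x * ψ x) + ∫ x, fn g x * ψ x := by
  rw [← integral_add hf hg]
  refine integral_congr_ae ?_
  filter_upwards [fn_add f g] with x hx
  rw [hx, add_mul]

lemma integral_smul_mul (c : ℝ) (f : L2per C) (ψ : X d → ℝ) :
    ∫ x, fn (c • f) x * ψ x = c * ∫ x, fn f x * ψ x := by
  rw [← integral_const_mul]
  refine integral_congr_ae ?_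
  filter_upwards [fn_smul c f] with x hx
  rw [hx, mul_assoc]

lemma integral_zero_mul (ψ : X d → ℝ) : ∫ x, fn (0 : L2per C) x * ψ x = 0 := by
  refine (integral_congr_ae ?_).trans (integral_zero (X d) ℝ)
  filter_upwards [fn_zero (C := C)] with x hx
  rw [hx, zero_mul]

/-- `∂_j f = g` in the sense of distributions on `ℝ^d`. -/
def IsWeakPartial (j : Fin d) (f g : L2per C) : Prop :=
  ∀ φ : X d → ℝ, IsTest φ → ∫ x, fn f x * pderiv j φ x = - ∫ x, fn g x * φ x

/-- The vector field `w` belongs to `H¹_per(V)`, with gradient `G`: all components `w i` and all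
distributional derivatives `∂_j (w i) = G i j` lie in `L²_per(V)`. -/
def IsH1Gradient (w : Fin d → L2per C) (G : Fin d → Fin d → L2per C) : Prop :=
  ∀ i j, IsWeakPartial j (w i) (G i j)

/-- The space `E_0` of compatible strain fields: symmetrized gradients of periodic displacement
fields in `H¹_per(V)`. -/
def E0 (C : UnitCell d) (L : ElasticityTensor d) : Submodule ℝ (He C L) where
  carrier := {e | ∃ w G, IsH1Gradient w G ∧
    ∀ i j, e.field.1 i j = (1 / 2 : ℝ) • (G i j + G j i)}
  add_mem' := by
    rintro e e' ⟨w, G, h, he⟩ ⟨w', G', h', he'⟩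
    refine ⟨w + w', G + G', fun i j φ hφ => ?_, fun i j => ?_⟩
    · simp only [Pi.add_apply]
      rw [integral_add_mul (integrable_mul_pderiv _ hφ j) (integrable_mul_pderiv _ hφ j),
        integral_add_mul (integrable_mul_test _ hφ) (integrable_mul_test _ hφ), h i j φ hφ,
        h' i j φ hφ, neg_add]
    · simp only [map_add, Submodule.coe_add, Pi.add_apply, he, he']
      module
  zero_mem' := by
    refine ⟨0, 0, fun i j φ hφ => ?_, fun i j => ?_⟩
    · simp only [Pi.zero_apply, integral_zero_mul, neg_zero]
    · simp
  smul_mem' := by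
    rintro c e ⟨w, G, h, he⟩
    refine ⟨c • w, c • G, fun i j φ hφ => ?_, fun i j => ?_⟩
    · simp only [Pi.smul_apply, integral_smul_mul]
      rw [h i j φ hφ, mul_neg]
    · simp only [map_smul, Submodule.coe_smul, Pi.smul_apply, he]
      module

/-- The space `U_s` of uniform stress fields. -/
def Us (C : UnitCell d) : Submodule ℝ (Hs C) where
  carrier := {s | ∃ c : Fin d → Fin d → ℝ, ∀ i j, comp s i j =ᵐ[volume] fun _ => c i j}
  add_mem' := by
    rintro s t ⟨c, hc⟩ ⟨b, hb⟩
    refine ⟨c + b, fun i j => ?_⟩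
    filter_upwards [hc i j, hb i j, fn_add (s.1 i j) (t.1 i j)] with x h1 h2 h3
    exact h3.trans (congrArg₂ (· + ·) h1 h2)
  zero_mem' := ⟨0, fun _ _ => fn_zero⟩
  smul_mem' := by
    rintro a s ⟨c, hc⟩
    refine ⟨a • c, fun i j => ?_⟩
    filter_upwards [hc i j, fn_smul a (s.1 i j)] with x h1 h3
    exact h3.trans (congrArg (a * ·) h1)

/-- The space `S_0` of self-equilibrated stress fields. A periodic field is divergence-free in the
cell with anti-periodic normal trace on the boundary of the cell precisely when its divergence
`(div s)_i = ∑_j ∂_j s_{ij}` vanishes as a distribution on `ℝ^d`, which also makes sense for fields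
that are merely `L²_per(V)`. The elements of `S_0` are moreover mean-free. -/
def S0 (C : UnitCell d) : Submodule ℝ (Hs C) where
  carrier := {s | (∀ φ : X d → ℝ, IsTest φ → ∀ i, ∑ j, ∫ x, comp s i j x * pderiv j φ x = 0) ∧
    ∀ i j, cellAverage C (comp s i j) = 0}
  add_mem' := by
    rintro s t ⟨hs, hs'⟩ ⟨ht, ht'⟩
    refine ⟨fun φ hφ i => ?_, fun i j => ?_⟩
    · have h : ∀ j, ∫ x, comp (s + t) i j x * pderiv j φ x =
          (∫ x, comp s i j x * pderiv j φ x) + ∫ x, comp t i j x * pderiv j φ x := fun j =>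
        integral_add_mul (integrable_mul_pderiv _ hφ j) (integrable_mul_pderiv _ hφ j)
      simp only [h, Finset.sum_add_distrib, hs φ hφ i, ht φ hφ i, add_zero]
    · have := hs' i j
      have h2 := ht' i j
      rw [cellAverage, setAverage_eq] at *
      have hV : IsFiniteMeasure (volume.restrict C.V) :=
        ⟨by simpa using C.volume_ne_top.lt_top⟩
      have h3 : ∫ x in C.V, comp (s + t) i j x =
          (∫ x in C.V, comp s i j x) + ∫ x in C.V, comp t i j x := by
        refine Eq.trans ?_ (integral_add ((memLp_cell (s.1 i j)).integrable (by norm_num))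
          ((memLp_cell (t.1 i j)).integrable (by norm_num)))
        exact integral_congr_ae (ae_restrict_of_ae (fn_add (s.1 i j) (t.1 i j)))
      rw [h3, smul_add, this, h2, add_zero]
  zero_mem' := by
    refine ⟨fun φ hφ i => ?_, fun i j => ?_⟩
    · exact Finset.sum_eq_zero fun j _ => integral_zero_mul _
    · rw [cellAverage, setAverage_eq]
      have h3 : ∫ x in C.V, comp (0 : SymL2per C) i j x = 0 :=
        (integral_congr_ae (ae_restrict_of_ae fn_zero)).trans (integral_zero (X d) ℝ)
      rw [h3, smul_zero]
  smul_mem' := by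
    rintro a s ⟨hs, hs'⟩
    refine ⟨fun φ hφ i => ?_, fun i j => ?_⟩
    · have h : ∀ j, ∫ x, comp (a • s) i j x * pderiv j φ x =
          a * ∫ x, comp s i j x * pderiv j φ x := fun j => integral_smul_mul a _ _
      simp only [h, ← Finset.mul_sum, hs φ hφ i, mul_zero]
    · have := hs' i j
      rw [cellAverage, setAverage_eq] at *
      have h3 : ∫ x in C.V, comp (a • s) i j x = a * ∫ x in C.V, comp s i j x := by
        rw [← integral_const_mul]
        exact integral_congr_ae (ae_restrict_of_ae (fn_smul a (s.1 i j)))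
      rw [h3, ← smul_eq_mul a, smul_comm, this, smul_zero]

/-- The space `S = U_s ⊕ S_0` of statically admissible stress fields. -/
def S (C : UnitCell d) : Submodule ℝ (Hs C) := Us C ⊔ S0 C

/-- The Eshelby problem with data `τ`: `e` is a compatible strain field of `E_0` such that
`L e - τ` is statically admissible. -/
def SolvesEshelby (L : ElasticityTensor d) (τ : Hs C) (e : He C L) : Prop :=
  e ∈ E0 C L ∧ stiffness L e - τ ∈ S C

open Classical in
/-- The strain Green's operator `Γ_0 : H_s → H_e`, sending `τ` to the solution of the Eshelby
problem with data `τ` (and to `0` should there be no solution). -/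
def Green (L : ElasticityTensor d) (τ : Hs C) : He C L :=
  if h : ∃ e : He C L, SolvesEshelby L τ e then h.choose else 0

end PeriodicElasticity

end

open PeriodicElasticity

/-! Everything reduces to one fact: under the duality product, `S C` is the annihilator of `E0 C L`
(`mem_S_iff`). The Eshelby problem then takes the weak form (`solvesEshelby_iff`): `e` lies in `E0 C
L` and its energetic product with every compatible strain `ε` equals the duality product of `τ` with
`ε`. A Riesz representer `ξ` of `τ` turns this into the statement that `e` is the orthogonal
projection of `ξ` onto `E0 C L`. When `τ` is the stiffness applied to `η`, the representer is `η`
itself, so the operator sends `η` to its projection. Idempotence, self-adjointness and the behaviour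
on `E0 C L` are then properties of orthogonal projections.

Three analytic facts support this argument. The space `He C L` is complete (`completeSpace_he`):
uniform positive definiteness makes the energetic norm equivalent to the `L²` norm. The subspace `E0
C L` is closed (`isClosed_E0`): by the Korn and Poincaré inequalities a mean-free displacement,
together with its gradient, is controlled by its strain. The annihilator property is an integration
by parts in one direction; in the other, the displacement is a periodized test function.

The common tool is Fourier series. Weak derivatives are tested on compactly supported functions on
the whole space, whereas averages live on a cell. `isWeakDiv_iff` and `isWeakPartial_iff` replace
the distributional relations by algebraic relations between Fourier coefficients; Parseval's
identity then yields integration by parts, Korn and Poincaré one mode at a time. An arbitrary unit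
cell is first exchanged for the parallelepiped of the periods, hence for the torus. -/

noncomputable section

namespace PeriodicElasticity

variable {d : ℕ} {C : UnitCell d}

/-! ### Periodic fields as functions on the torus -/

/-- The Haar probability measure on the `d`-dimensional torus. -/
abbrev torusMeasure (d : ℕ) : Measure (UnitAddTorus (Fin d)) :=
  Measure.pi fun _ => AddCircle.haarAddCircle

/-- The half-open parallelepiped spanned by the periods. -/
abbrev UnitCell.box (C : UnitCell d) : Set (X d) := ZSpan.fundamentalDomain C.Y

lemma UnitCell.isAddFundamentalDomain_box (C : UnitCell d) :
    IsAddFundamentalDomain C.lattice C.box (volume : Measure (X d)) :=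
  ZSpan.isAddFundamentalDomain' C.Y volume

lemma UnitCell.volume_box (C : UnitCell d) : volume C.box = volume C.V :=
  (C.tiles.measure_eq C.isAddFundamentalDomain_box).symm

/-- The projection of space onto the torus, in the coordinates given by the periods. -/
def toTorus (C : UnitCell d) (x : X d) : UnitAddTorus (Fin d) :=
  fun i => (C.Y.equivFunL x i : UnitAddCircle)

/-- A section of `toTorus`. -/
def torusSection (C : UnitCell d) (t : UnitAddTorus (Fin d)) : X d :=
  C.Y.equivFunL.symm (UnitAddTorus.measurableEquivPiIoc (fun _ => (0 : ℝ)) t).1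

lemma measurable_toTorus (C : UnitCell d) : Measurable (toTorus C) :=
  measurable_pi_lambda _ fun i => AddCircle.measurable_mk'.comp
    ((measurable_pi_apply i).comp C.Y.equivFunL.continuous.measurable)

lemma measurable_torusSection (C : UnitCell d) : Measurable (torusSection C) :=
  C.Y.equivFunL.symm.continuous.measurable.comp
    (measurable_subtype_coe.comp (UnitAddTorus.measurableEquivPiIoc _).measurable)

lemma toTorus_torusSection (C : UnitCell d) (t : UnitAddTorus (Fin d)) :
    toTorus C (torusSection C t) = t := by
  refine Eq.trans (funext fun i => ?_)
    ((UnitAddTorus.measurableEquivPiIoc (fun _ => (0 : ℝ))).symm_apply_apply t)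
  rw [toTorus, torusSection, ContinuousLinearEquiv.apply_symm_apply]
  rfl

lemma toTorus_add (C : UnitCell d) {y : X d} (hy : y ∈ C.lattice) (x : X d) :
    toTorus C (y + x) = toTorus C x := by
  funext i
  obtain ⟨n, hn⟩ := (C.Y.mem_span_iff_repr_mem ℤ y).1 hy i
  have h : C.Y.equivFunL (y + x) i = C.Y.equivFunL x i + n • (1 : ℝ) := by
    rw [map_add, Pi.add_apply, add_comm]
    congr 1
    simpa using hn.symm
  simp only [toTorus, h]
  rw [AddCircle.coe_add, AddCircle.coe_zsmul, AddCircle.coe_period, smul_zero, add_zero]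

lemma UnitCell.box_eq_preimage (C : UnitCell d) :
    C.box = C.Y.equivFunL ⁻¹' (univ.pi fun _ => Ico (0 : ℝ) 1) := by
  ext x
  simp [UnitCell.box, ZSpan.fundamentalDomain]

/-- The normalized Lebesgue measure of the parallelepiped spanned by the periods. -/
abbrev cellMeasure (C : UnitCell d) : Measure (X d) :=
  (volume C.V)⁻¹ • volume.restrict C.box

instance (C : UnitCell d) : IsProbabilityMeasure (cellMeasure C) := by
  refine ⟨?_⟩
  rw [Measure.smul_apply, Measure.restrict_apply_univ, C.volume_box, smul_eq_mul]
  exact ENNReal.inv_mul_cancel C.volume_ne_zero C.volume_ne_top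

/-- The torus is unrolled onto a product of intervals open on the left, whereas the lattice
parallelepiped is open on the right; the two boxes differ by a null set. -/
lemma map_val_measurableEquivPiIoc :
    (torusMeasure d).map (fun t => (UnitAddTorus.measurableEquivPiIoc (fun _ => (0 : ℝ)) t).1) =
      volume.restrict (univ.pi fun _ => Ico (0 : ℝ) 1) := by
  have h1 := (UnitAddTorus.measurePreserving_equivPiIoc (fun _ : Fin d => (0 : ℝ))).map_eq
  have hm : MeasurableSet {x : Fin d → ℝ | ∀ i, x i ∈ Ioc (0 : ℝ) (0 + 1)} :=
    MeasurableSet.univ_pi' fun i => measurableSet_Ioc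
  have h2 := map_comap_subtype_coe hm volume
  have h3 : {x : Fin d → ℝ | ∀ i, x i ∈ Ioc (0 : ℝ) (0 + 1)} =
      univ.pi fun _ => Ioc (0 : ℝ) 1 := by ext; simp
  have h4 : (univ.pi fun _ : Fin d => Ioc (0 : ℝ) 1) =ᵐ[volume]
      univ.pi fun _ => Ico (0 : ℝ) 1 :=
    Measure.univ_pi_Ioc_ae_eq_Icc.trans Measure.univ_pi_Ico_ae_eq_Icc.symm
  rw [← Measure.restrict_congr_set h4, ← h3]
  refine Eq.trans ?_ h2
  refine Eq.trans ?_ (congrArg _ h1)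
  exact (Measure.map_map measurable_subtype_coe
    (UnitAddTorus.measurableEquivPiIoc (fun _ : Fin d => (0 : ℝ))).measurable).symm

lemma measurePreserving_torusSection (C : UnitCell d) :
    MeasurePreserving (torusSection C) (torusMeasure d) (cellMeasure C) := by
  refine ⟨measurable_torusSection C, ?_⟩
  -- A linear isomorphism carries Lebesgue measure to a Haar measure, hence to a multiple of
  -- Lebesgue measure. The factor need not be computed as a determinant: comparing total masses
  -- determines it below.
  obtain ⟨k, hk⟩ : ∃ k : ℝ≥0∞, volume.map C.Y.equivFunL.symm = k • (volume : Measure (X d)) := by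
    have := C.Y.equivFunL.symm.isAddHaarMeasure_map (volume : Measure (Fin d → ℝ))
    exact ⟨_, Measure.isAddLeftInvariant_eq_smul _ _⟩
  have h1 : (torusMeasure d).map (torusSection C) = k • volume.restrict C.box := by
    rw [← Measure.restrict_smul, ← hk,
      Measure.restrict_map C.Y.equivFunL.symm.continuous.measurable
        (ZSpan.fundamentalDomain_measurableSet C.Y)]
    change _ = Measure.map _ (volume.restrict (_ ⁻¹' C.box))
    rw [C.box_eq_preimage, ← preimage_comp]
    simp only [ContinuousLinearEquiv.self_comp_symm, preimage_id]
    rw [← map_val_measurableEquivPiIoc]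
    exact (Measure.map_map C.Y.equivFunL.symm.continuous.measurable
      (measurable_subtype_coe.comp (UnitAddTorus.measurableEquivPiIoc _).measurable)).symm
  have h2 : k * volume C.V = 1 := by
    have : ((torusMeasure d).map (torusSection C)) univ = 1 := by
      rw [Measure.map_apply (measurable_torusSection C) MeasurableSet.univ, preimage_univ,
        measure_univ]
    rwa [h1, Measure.smul_apply, Measure.restrict_apply_univ, C.volume_box] at this
  rw [h1, cellMeasure, ENNReal.eq_inv_of_mul_eq_one_left h2]

lemma cellMeasure_absolutelyContinuous (C : UnitCell d) : cellMeasure C ≪ volume :=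
  (Measure.absolutelyContinuous_of_le Measure.restrict_le_self).smul_left _

lemma quasiMeasurePreserving_torusSection (C : UnitCell d) :
    Measure.QuasiMeasurePreserving (torusSection C) (torusMeasure d) volume :=
  (measurePreserving_torusSection C).quasiMeasurePreserving.mono_right
    (cellMeasure_absolutelyContinuous C)

/-- The preimage of a set of the torus is invariant under the lattice, so it is null as soon as its
part in the parallelepiped is null, and that part has the measure of the set itself up to
normalization. -/
lemma quasiMeasurePreserving_toTorus (C : UnitCell d) :
    Measure.QuasiMeasurePreserving (toTorus C) volume (torusMeasure d) := by
  refine ⟨measurable_toTorus C, Measure.AbsolutelyContinuous.mk fun s hs h0 => ?_⟩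
  rw [Measure.map_apply (measurable_toTorus C) hs]
  refine C.isAddFundamentalDomain_box.measure_zero_of_invariant _ (fun y => ?_) ?_
  · ext x
    rw [mem_vadd_set_iff_neg_vadd_mem, AddSubgroup.vadd_def, vadd_eq_add, mem_preimage,
      mem_preimage, toTorus_add C (-y).2]
  · have h1 := (measurePreserving_torusSection C).measure_preimage
      (measurable_toTorus C hs).nullMeasurableSet
    rw [← preimage_comp, show toTorus C ∘ torusSection C = id from
      funext (toTorus_torusSection C), preimage_id, h0, Measure.smul_apply,
      Measure.restrict_apply (measurable_toTorus C hs), smul_eq_mul] at h1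
    exact (mul_eq_zero.1 h1.symm).resolve_left (ENNReal.inv_ne_zero.2 C.volume_ne_top)

lemma measurePreserving_toTorus (C : UnitCell d) :
    MeasurePreserving (toTorus C) (cellMeasure C) (torusMeasure d) := by
  refine ⟨measurable_toTorus C, ?_⟩
  rw [← (measurePreserving_torusSection C).map_eq,
    Measure.map_map (measurable_toTorus C) (measurable_torusSection C),
    show toTorus C ∘ torusSection C = id from funext (toTorus_torusSection C), Measure.map_id]

/-- Integrals of a.e. periodic functions do not depend on the fundamental domain. -/
lemma setIntegral_periodic {s t : Set (X d)} {F : X d → ℝ}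
    (hs : IsAddFundamentalDomain C.lattice s (volume : Measure (X d)))
    (ht : IsAddFundamentalDomain C.lattice t (volume : Measure (X d)))
    (hFs : IntegrableOn F s) (hFt : IntegrableOn F t)
    (hF : ∀ y : C.lattice, (fun x => F (y +ᵥ x)) =ᵐ[volume] F) :
    ∫ x in s, F x = ∫ x in t, F x := by
  rw [ht.setIntegral_eq_tsum hFs, hs.setIntegral_eq_tsum' hFt]
  refine tsum_congr fun g => ?_
  rw [inter_comm]
  exact (integral_congr_ae (ae_restrict_of_ae (hF (-g)))).symm

open scoped Pointwise in
/-- The integral of a nonnegative periodic function over a compact set is controlled by its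
integral over a cell. -/
lemma exists_setLIntegral_compact_le (C : UnitCell d) {K : Set (X d)} (hK : IsCompact K) :
    ∃ N : ℕ, ∀ F : X d → ℝ≥0∞, (∀ y : C.lattice, (fun x => F (y +ᵥ x)) =ᵐ[volume] F) →
      ∫⁻ x in K, F x ≤ N * ∫⁻ x in C.box, F x := by
  -- A point differs from its integer part in the lattice by a bounded vector, so the integer parts
  -- of the points of a bounded set form a bounded, hence finite, set of lattice vectors. Their
  -- number is the constant `N`.
  have hfin : (range fun x : K => (ZSpan.floor C.Y (x : X d) : X d)).Finite := by
    obtain ⟨R, hR⟩ := hK.isBounded.exists_norm_le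
    have h1 : Bornology.IsBounded (Metric.closedBall (0 : X d) (R + ∑ i, ‖C.Y i‖)) :=
      Metric.isBounded_closedBall
    refine (ZSpan.setFinite_inter C.Y h1).subset ?_
    rintro _ ⟨x, rfl⟩
    refine ⟨?_, (ZSpan.floor C.Y (x : X d)).2⟩
    have h2 : (ZSpan.floor C.Y (x : X d) : X d) = x - ZSpan.fract C.Y (x : X d) := by
      rw [ZSpan.fract_apply, sub_sub_cancel]
    rw [mem_closedBall_zero_iff]
    beta_reduce
    rw [h2]
    exact (norm_sub_le _ _).trans (add_le_add (hR x x.2) (ZSpan.norm_fract_le C.Y _))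
  refine ⟨hfin.toFinset.card, fun F hF => ?_⟩
  have hsub : K ⊆ ⋃ y ∈ hfin.toFinset, y +ᵥ C.box := by
    intro x hx
    simp only [mem_iUnion, Finite.mem_toFinset]
    refine ⟨ZSpan.floor C.Y x, ⟨⟨x, hx⟩, rfl⟩, ZSpan.fract C.Y x,
      ZSpan.fract_mem_fundamentalDomain C.Y x, ?_⟩
    change (ZSpan.floor C.Y x : X d) + ZSpan.fract C.Y x = x
    rw [ZSpan.fract_apply, add_sub_cancel]
  calc ∫⁻ x in K, F x ≤ ∫⁻ x in ⋃ y ∈ hfin.toFinset, y +ᵥ C.box, F x :=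
        lintegral_mono_set hsub
    _ ≤ ∑ y ∈ hfin.toFinset, ∫⁻ x in y +ᵥ C.box, F x := by
        classical
        induction hfin.toFinset using Finset.induction_on with
        | empty => simp
        | insert a s ha ih =>
          rw [Finset.set_biUnion_insert, Finset.sum_insert ha]
          exact (lintegral_union_le _ _ _).trans (add_le_add le_rfl ih)
    _ = ∑ y ∈ hfin.toFinset, ∫⁻ x in C.box, F x :=
        Finset.sum_congr rfl fun y _ => setLIntegral_periodic
          (C.isAddFundamentalDomain_box.vadd_of_comm y) C.isAddFundamentalDomain_box hF
    _ = _ := by rw [Finset.sum_const, nsmul_eq_mul]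

lemma memLp_box (f : L2per C) : MemLp (fn f) 2 (volume.restrict C.box) :=
  (f.2.1 _ (ZSpan.fundamentalDomain_isBounded C.Y).isCompact_closure).mono_measure
    (Measure.restrict_mono subset_closure le_rfl)

lemma memLp_cellMeasure (f : L2per C) : MemLp (fn f) 2 (cellMeasure C) :=
  (memLp_box f).smul_measure (ENNReal.inv_ne_top.2 C.volume_ne_zero)

lemma avgMul_eq_cellMeasure (f g : L2per C) :
    avgMul f g = ∫ x, fn f x * fn g x ∂(cellMeasure C) := by
  rw [integral_smul_measure, avgMul, LinearMap.mk₂_apply, cellAverage, setAverage_eq]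
  rw [setIntegral_periodic C.tiles C.isAddFundamentalDomain_box (integrable_mul_cell f g)
    ((memLp_box f).integrable_mul (memLp_box g)), ENNReal.toReal_inv]
  · rfl
  · intro y
    filter_upwards [fn_vadd f y, fn_vadd g y] with x h1 h2
    rw [h1, h2]

/-- The Hilbert space of real square-integrable functions on the torus. -/
abbrev TorusL2 (d : ℕ) : Type := Lp ℝ 2 (torusMeasure d)

lemma memLp_torus (f : L2per C) :
    MemLp (fun t => fn f (torusSection C t)) 2 (torusMeasure d) :=
  (memLp_cellMeasure f).comp_measurePreserving (measurePreserving_torusSection C)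

lemma exists_memLp_compact {F : X d → ℝ} (hm : AEStronglyMeasurable F volume)
    (hF : ∀ y : C.lattice, (fun x => F (y +ᵥ x)) =ᵐ[volume] F)
    (hb : MemLp F 2 (volume.restrict C.box)) {K : Set (X d)} (hK : IsCompact K) :
    MemLp F 2 (volume.restrict K) := by
  refine ⟨hm.restrict, ?_⟩
  have h2 := hb.2
  rw [eLpNorm_lt_top_iff_lintegral_rpow_enorm_lt_top (by norm_num) (by norm_num)] at h2 ⊢
  obtain ⟨N, hN⟩ := exists_setLIntegral_compact_le C hK
  refine (hN _ fun y => ?_).trans_lt (ENNReal.mul_lt_top (ENNReal.natCast_lt_top N) h2)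
  filter_upwards [hF y] with x hx
  rw [hx]

/-- The periodic field on space defined by a function on the torus. -/
def ofTorus (C : UnitCell d) (F : TorusL2 d) : L2per C := by
  refine ⟨F.1.compQuasiMeasurePreserving (toTorus C) (quasiMeasurePreserving_toTorus C), ?_⟩
  have hc := AEEqFun.coeFn_compQuasiMeasurePreserving F.1 (quasiMeasurePreserving_toTorus C)
  have hper : ∀ y ∈ C.lattice, ∀ x, F (toTorus C (y + x)) = F (toTorus C x) :=
    fun y hy x => by rw [toTorus_add C hy]
  refine ⟨fun K hK => ?_, fun y hy => ?_⟩
  · refine MemLp.ae_eq (ae_restrict_of_ae hc.symm) ?_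
    refine exists_memLp_compact (C := C) ?_
      (fun y => Eventually.of_forall fun x => hper y y.2 x) ?_ hK
    · exact F.1.aestronglyMeasurable.comp_quasiMeasurePreserving (quasiMeasurePreserving_toTorus C)
    · have h1 : MemLp (fun x => F (toTorus C x)) 2 (cellMeasure C) :=
        (Lp.memLp F).comp_measurePreserving (measurePreserving_toTorus C)
      refine h1.of_measure_le_smul (c := volume C.V) C.volume_ne_top ?_
      rw [cellMeasure, smul_smul, ENNReal.mul_inv_cancel C.volume_ne_zero C.volume_ne_top, one_smul]
  · filter_upwards [hc, (quasi_translate y).ae hc] with x h1 h2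
    rw [h1, h2, add_comm]
    exact hper y hy x

lemma fn_ofTorus (F : TorusL2 d) : fn (ofTorus C F) =ᵐ[volume] fun x => F (toTorus C x) :=
  AEEqFun.coeFn_compQuasiMeasurePreserving F.1 (quasiMeasurePreserving_toTorus C)

/-- Periodic fields as functions on the torus. -/
def toTorusL2Aux (C : UnitCell d) : L2per C →ₗ[ℝ] TorusL2 d where
  toFun f := (memLp_torus f).toLp
  map_add' f g := by
    rw [← MemLp.toLp_add]
    exact MemLp.toLp_congr _ _ ((quasiMeasurePreserving_torusSection C).ae (fn_add f g))
  map_smul' c f := by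
    rw [RingHom.id_apply, ← MemLp.toLp_const_smul]
    exact MemLp.toLp_congr _ _ ((quasiMeasurePreserving_torusSection C).ae (fn_smul c f))

lemma toTorusL2Aux_ae (f : L2per C) :
    toTorusL2Aux C f =ᵐ[torusMeasure d] fun t => fn f (torusSection C t) :=
  MemLp.coeFn_toLp (memLp_torus f)

lemma inner_toTorusL2Aux (f g : L2per C) :
    inner ℝ (toTorusL2Aux C f) (toTorusL2Aux C g) = avgMul f g := by
  rw [avgMul_eq_cellMeasure, L2.inner_def, ← (measurePreserving_torusSection C).map_eq,
    integral_map (measurable_torusSection C).aemeasurable]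
  · refine integral_congr_ae ?_
    filter_upwards [toTorusL2Aux_ae f, toTorusL2Aux_ae g] with t h1 h2
    rw [h1, h2, RCLike.inner_apply', conj_trivial]
  · rw [(measurePreserving_torusSection C).map_eq]
    exact ((aesm f).mul (aesm g)).mono_ac (cellMeasure_absolutelyContinuous C)

lemma eq_zero_of_avgMul_self {f : L2per C} (h : avgMul f f = 0) : f = 0 := by
  rw [avgMul, LinearMap.mk₂_apply, cellAverage, setAverage_eq, smul_eq_zero] at h
  have hV : (volume.real C.V)⁻¹ ≠ 0 :=
    inv_ne_zero (ENNReal.toReal_ne_zero.2 ⟨C.volume_ne_zero, C.volume_ne_top⟩)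
  have h1 := h.resolve_left hV
  rw [integral_eq_zero_iff_of_nonneg (fun x => mul_self_nonneg _) (integrable_mul_cell f f)] at h1
  refine eq_zero_of_ae f (h1.mono fun x hx => ?_)
  simpa using hx

lemma bijective_toTorusL2Aux (C : UnitCell d) : Function.Bijective (toTorusL2Aux C) := by
  refine ⟨(injective_iff_map_eq_zero _).2 fun f hf => ?_, fun F => ⟨ofTorus C F, ?_⟩⟩
  · refine eq_zero_of_avgMul_self ?_
    rw [← inner_toTorusL2Aux, hf, inner_zero_left]
  · refine Lp.ext ((toTorusL2Aux_ae _).trans ?_)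
    filter_upwards [(quasiMeasurePreserving_torusSection C).ae (fn_ofTorus F)] with t ht
    rw [ht, toTorus_torusSection]

/-- The identification of `L²_per(V)` with the `L²` space of the torus. -/
def toTorusL2 (C : UnitCell d) : L2per C ≃ₗ[ℝ] TorusL2 d :=
  LinearEquiv.ofBijective (toTorusL2Aux C) (bijective_toTorusL2Aux C)

lemma toTorusL2_ae (f : L2per C) :
    toTorusL2 C f =ᵐ[torusMeasure d] fun t => fn f (torusSection C t) :=
  toTorusL2Aux_ae f

lemma inner_toTorusL2 (f g : L2per C) :
    inner ℝ (toTorusL2 C f) (toTorusL2 C g) = avgMul f g :=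
  inner_toTorusL2Aux f g

lemma norm_toTorusL2_sq (f : L2per C) : ‖toTorusL2 C f‖ ^ 2 = avgMul f f := by
  rw [← real_inner_self_eq_norm_sq, inner_toTorusL2]

lemma avgMul_eq_torus (f g : L2per C) :
    avgMul f g = ∫ t, fn f (torusSection C t) * fn g (torusSection C t) ∂(torusMeasure d) := by
  rw [← inner_toTorusL2, L2.inner_def]
  refine integral_congr_ae ?_
  filter_upwards [toTorusL2_ae f, toTorusL2_ae g] with t h1 h2
  rw [h1, h2, RCLike.inner_apply', conj_trivial]

/-! ### Plane waves and Parseval's identity -/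

/-- The element of `L²_per(V)` defined by a continuous periodic function. -/
def ofContinuous (C : UnitCell d) (h : X d → ℝ) (hc : Continuous h)
    (hp : ∀ y ∈ C.lattice, ∀ x, h (x + y) = h x) : L2per C := by
  refine ⟨AEEqFun.mk h hc.aestronglyMeasurable, fun K hK => ?_, fun y hy => ?_⟩
  · have : IsFiniteMeasure (volume.restrict K) := ⟨by simpa using hK.measure_lt_top⟩
    obtain ⟨R, hR⟩ := hK.exists_bound_of_continuousOn hc.continuousOn
    refine MemLp.ae_eq (ae_restrict_of_ae (AEEqFun.coeFn_mk h hc.aestronglyMeasurable).symm) ?_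
    refine MemLp.of_bound hc.aestronglyMeasurable R ?_
    filter_upwards [ae_restrict_mem hK.measurableSet] with x hx using hR x hx
  · have h1 := AEEqFun.coeFn_mk h hc.aestronglyMeasurable (μ := (volume : Measure (X d)))
    filter_upwards [h1, (quasi_translate y).ae h1] with x h2 h3
    rw [h2, h3, hp y hy]

lemma fn_ofContinuous {h : X d → ℝ} (hc : Continuous h)
    (hp : ∀ y ∈ C.lattice, ∀ x, h (x + y) = h x) : fn (ofContinuous C h hc hp) =ᵐ[volume] h :=
  AEEqFun.coeFn_mk h hc.aestronglyMeasurable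

/-- The phase of the plane wave whose wave vector is the reciprocal lattice vector of index `k`. -/
def phase (C : UnitCell d) (k : Fin d → ℤ) : X d →L[ℝ] ℝ :=
  (2 * Real.pi) • ∑ i, (k i : ℝ) • ((ContinuousLinearMap.proj i).comp
    (C.Y.equivFunL : X d →L[ℝ] Fin d → ℝ))

lemma phase_apply (C : UnitCell d) (k : Fin d → ℤ) (x : X d) :
    phase C k x = 2 * Real.pi * ∑ i, k i * C.Y.equivFunL x i := by
  simp [phase]

lemma mFourier_toTorus (C : UnitCell d) (k : Fin d → ℤ) (x : X d) :
    UnitAddTorus.mFourier k (toTorus C x) = Complex.exp (phase C k x * Complex.I) := by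
  simp only [UnitAddTorus.mFourier, ContinuousMap.coe_mk, toTorus, fourier_coe_apply]
  rw [← Complex.exp_sum, phase_apply]
  congr 1
  push_cast
  rw [Finset.mul_sum, Finset.sum_mul]
  refine Finset.sum_congr rfl fun i _ => ?_
  ring

lemma exp_phase_add (C : UnitCell d) (k : Fin d → ℤ) {y : X d} (hy : y ∈ C.lattice) (x : X d) :
    Complex.exp (phase C k (x + y) * Complex.I) = Complex.exp (phase C k x * Complex.I) := by
  rw [← mFourier_toTorus, ← mFourier_toTorus, add_comm, toTorus_add C hy]

lemma cos_phase_add (C : UnitCell d) (k : Fin d → ℤ) (y : X d) (hy : y ∈ C.lattice) (x : X d) :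
    Real.cos (phase C k (x + y)) = Real.cos (phase C k x) := by
  have h := congrArg Complex.re (exp_phase_add C k hy x)
  rwa [Complex.exp_ofReal_mul_I_re, Complex.exp_ofReal_mul_I_re] at h

lemma sin_phase_add (C : UnitCell d) (k : Fin d → ℤ) (y : X d) (hy : y ∈ C.lattice) (x : X d) :
    Real.sin (phase C k (x + y)) = Real.sin (phase C k x) := by
  have h := congrArg Complex.im (exp_phase_add C k hy x)
  rwa [Complex.exp_ofReal_mul_I_im, Complex.exp_ofReal_mul_I_im] at h

/-- The cosine wave of index `k`. -/
def cosMode (C : UnitCell d) (k : Fin d → ℤ) : L2per C :=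
  ofContinuous C (fun x => Real.cos (phase C k x))
    (Real.continuous_cos.comp (phase C k).continuous) (cos_phase_add C k)

/-- The sine wave of index `k`. -/
def sinMode (C : UnitCell d) (k : Fin d → ℤ) : L2per C :=
  ofContinuous C (fun x => Real.sin (phase C k x))
    (Real.continuous_sin.comp (phase C k).continuous) (sin_phase_add C k)

lemma fn_cosMode (k : Fin d → ℤ) :
    fn (cosMode C k) =ᵐ[volume] fun x => Real.cos (phase C k x) := fn_ofContinuous _ _

lemma fn_sinMode (k : Fin d → ℤ) :
    fn (sinMode C k) =ᵐ[volume] fun x => Real.sin (phase C k x) := fn_ofContinuous _ _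

/-- The complexification of a periodic field, as a function on the torus. -/
def complexTorusL2 (f : L2per C) : Lp ℂ 2 (torusMeasure d) :=
  (memLp_torus f).ofReal.toLp

lemma complexTorusL2_ae (f : L2per C) : complexTorusL2 f =ᵐ[torusMeasure d]
    fun t => ((fn f (torusSection C t) : ℝ) : ℂ) :=
  MemLp.coeFn_toLp (memLp_torus f).ofReal

lemma mFourierCoeff_complexTorusL2 (f : L2per C) (k : Fin d → ℤ) :
    (∫ t, UnitAddTorus.mFourier (-k) t • complexTorusL2 f t ∂(torusMeasure d)) =
      (avgMul f (cosMode C k) : ℂ) - avgMul f (sinMode C k) * Complex.I := by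
  have h1 : ∀ g : L2per C, Integrable
      (fun t => ((fn f (torusSection C t) * fn g (torusSection C t) : ℝ) : ℂ)) (torusMeasure d) :=
    fun g => ((memLp_torus f).integrable_mul (memLp_torus g)).ofReal
  rw [avgMul_eq_torus, avgMul_eq_torus, ← integral_complex_ofReal, ← integral_complex_ofReal,
    ← integral_mul_const, ← integral_sub (h1 _) ((h1 _).mul_const _)]
  refine integral_congr_ae ?_
  filter_upwards [complexTorusL2_ae f,
    (quasiMeasurePreserving_torusSection C).ae (fn_cosMode k),
    (quasiMeasurePreserving_torusSection C).ae (fn_sinMode k)] with t h2 h3 h4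
  rw [h2, h3, h4, UnitAddTorus.mFourier_neg]
  nth_rewrite 1 [← toTorus_torusSection C t]
  rw [mFourier_toTorus, Complex.exp_mul_I, ← Complex.ofReal_cos, ← Complex.ofReal_sin]
  simp only [map_add, map_mul, Complex.conj_ofReal, Complex.conj_I, smul_eq_mul,
    Complex.ofReal_mul]
  ring

/-- **Parseval's identity** for periodic fields. -/
lemma hasSum_avgMul (f g : L2per C) :
    HasSum (fun k => avgMul f (cosMode C k) * avgMul g (cosMode C k) +
      avgMul f (sinMode C k) * avgMul g (sinMode C k)) (avgMul f g) := by
  -- The coefficients are `a - b i` with `a`, `b` the cosine and sine averages, and the real part of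
  -- a conjugate product is the sum of the two real products. No factor 2 appears because `k` and
  -- `-k` are both summed.
  have h := Complex.hasSum_re
    (UnitAddTorus.hasSum_prod_mFourierCoeff (complexTorusL2 f) (complexTorusL2 g))
  convert h using 1
  · funext k
    have h1 : ∀ f : L2per C, UnitAddTorus.mFourierCoeff (complexTorusL2 f) k =
      (avgMul f (cosMode C k) : ℂ) - avgMul f (sinMode C k) * Complex.I :=
      fun f => mFourierCoeff_complexTorusL2 f k
    rw [h1, h1]
    simp
  · have h2 : (∫ t, (starRingEnd ℂ) (complexTorusL2 f t) * complexTorusL2 g t ∂(torusMeasure d)) =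
        (avgMul f g : ℂ) := by
      rw [avgMul_eq_torus, ← integral_complex_ofReal]
      refine integral_congr_ae ?_
      filter_upwards [complexTorusL2_ae f, complexTorusL2_ae g] with t h3 h4
      rw [h3, h4]
      simp
    exact (congrArg Complex.re h2).symm

/-! ### From compactly supported to periodic test functions -/

/-- The cell average, up to normalization, of a periodic function is translation invariant. -/
lemma integral_box_translate {h : X d → ℝ} (hl : LocallyIntegrable h volume)
    (hp : ∀ y : C.lattice, (fun x => h (y +ᵥ x)) =ᵐ[volume] h) (u : X d) :
    IntegrableOn (fun z => h (u + z)) C.box ∧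
      ∫ z in C.box, h (u + z) = ∫ z in C.box, h z := by
  have hb : ∀ v : X d, IntegrableOn h ((fun z => v + z) '' C.box) := fun v => by
    have h1 : Bornology.IsBounded ((fun z => v + z) '' C.box) :=
      (isometry_vadd (X d) v).lipschitz.isBounded_image
        (ZSpan.fundamentalDomain_isBounded C.Y)
    exact (hl.integrableOn_isCompact h1.isCompact_closure).mono_set subset_closure
  have hmp := measurePreserving_add_left (volume : Measure (X d)) u
  refine ⟨(hmp.integrableOn_image (measurableEmbedding_addLeft u)).1 (hb u), ?_⟩
  rw [← hmp.setIntegral_image_emb (measurableEmbedding_addLeft u)]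
  refine setIntegral_periodic (C.isAddFundamentalDomain_box.vadd_of_comm u)
    C.isAddFundamentalDomain_box (hb u) ?_ hp
  simpa using hb 0

lemma integrable_box_prod {h : X d → ℝ} (hl : LocallyIntegrable h volume)
    (hp : ∀ y : C.lattice, (fun x => h (y +ᵥ x)) =ᵐ[volume] h) {ρ : X d → ℝ}
    (hρ : Continuous ρ) (hρ' : HasCompactSupport ρ) :
    Integrable (Function.uncurry fun z u => h (u + z) * ρ u)
      ((volume.restrict C.box).prod volume) := by
  have hm : AEStronglyMeasurable (fun p : X d × X d => h (p.2 + p.1))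
      ((volume.restrict C.box).prod volume) := by
    have h1 := quasiMeasurePreserving_add (volume.restrict C.box) (volume : Measure (X d))
    simp only [add_comm]
    exact hl.aestronglyMeasurable.comp_quasiMeasurePreserving h1
  have hm' : AEStronglyMeasurable (Function.uncurry fun z u => h (u + z) * ρ u)
      ((volume.restrict C.box).prod volume) :=
    hm.mul (hρ.comp continuous_snd).aestronglyMeasurable
  refine (integrable_prod_iff' hm').2 ⟨?_, ?_⟩
  · exact Eventually.of_forall fun u => (integral_box_translate hl hp u).1.mul_const (ρ u)
  · have h2 : ∀ u, ∫ z in C.box, ‖h (u + z) * ρ u‖ = (∫ z in C.box, ‖h z‖) * ‖ρ u‖ := fun u => by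
      simp only [norm_mul, integral_mul_const]
      congr 1
      refine (integral_box_translate (C := C) (h := fun x => ‖h x‖)
        (fun x => (hl x).norm) (fun y => ?_) u).2
      filter_upwards [hp y] with x hx
      rw [hx]
    simp only [Function.uncurry_apply_pair, h2]
    exact (hρ.integrable_of_hasCompactSupport hρ').norm.const_mul _

/-- Substituting `x = u + z` and applying Fubini, the inner integral over the cell no longer depends
on `u` by periodicity, so the double integral factorizes. This is what averages the compactly
supported cut-off away. -/
lemma integrableOn_integral_mul_translate {h : X d → ℝ} (hl : LocallyIntegrable h volume)
    (hp : ∀ y : C.lattice, (fun x => h (y +ᵥ x)) =ᵐ[volume] h) {ρ : X d → ℝ}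
    (hρ : Continuous ρ) (hρ' : HasCompactSupport ρ) :
    IntegrableOn (fun z => ∫ x, h x * ρ (x - z)) C.box ∧
      ∫ z in C.box, ∫ x, h x * ρ (x - z) = (∫ x in C.box, h x) * ∫ u, ρ u := by
  have h1 : ∀ z, ∫ x, h x * ρ (x - z) = ∫ u, h (u + z) * ρ u := fun z => by
    rw [← integral_add_right_eq_self _ z]
    simp only [add_sub_cancel_right]
  have h2 := integrable_box_prod hl hp hρ hρ'
  simp only [h1]
  refine ⟨h2.integral_prod_left, ?_⟩
  rw [integral_integral_swap h2]
  simp only [integral_mul_const, (integral_box_translate hl hp _).2, integral_const_mul]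

/-- The vector field `f` has divergence `g` in the sense of distributions. -/
def IsWeakDiv (f : Fin d → L2per C) (g : L2per C) : Prop :=
  ∀ φ : X d → ℝ, IsTest φ → ∑ j, ∫ x, fn (f j) x * pderiv j φ x = - ∫ x, fn g x * φ x

lemma continuous_pderiv {φ : X d → ℝ} (hφ : ContDiff ℝ ∞ φ) (j : Fin d) :
    Continuous (pderiv j φ) :=
  (hφ.continuous_fderiv (by simp)).clm_apply continuous_const

lemma IsTest.hasCompactSupport_pderiv {φ : X d → ℝ} (hφ : IsTest φ) (j : Fin d) :
    HasCompactSupport (pderiv j φ) :=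
  hφ.2.fderiv_apply (𝕜 := ℝ) (EuclideanSpace.single j 1)

lemma integral_mul_pderiv {W φ : X d → ℝ} (hW : ContDiff ℝ ∞ W) (hφ : IsTest φ) (j : Fin d) :
    ∫ x, W x * pderiv j φ x = - ∫ x, pderiv j W x * φ x := by
  refine integral_mul_fderiv_eq_neg_fderiv_mul_of_integrable ?_ ?_ ?_
    (fun x _ => hW.differentiable (by simp) x) (fun x _ => hφ.1.differentiable (by simp) x)
  · exact ((continuous_pderiv hW j).mul hφ.1.continuous).integrable_of_hasCompactSupport
      hφ.2.mul_left
  · exact (hW.continuous.mul (continuous_pderiv hφ.1 j)).integrable_of_hasCompactSupport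
      (hφ.hasCompactSupport_pderiv j).mul_left
  · exact (hW.continuous.mul hφ.1.continuous).integrable_of_hasCompactSupport hφ.2.mul_left

lemma integral_pderiv {φ : X d → ℝ} (hφ : IsTest φ) (j : Fin d) : ∫ x, pderiv j φ x = 0 := by
  have h := integral_mul_pderiv (W := fun _ => (1 : ℝ)) contDiff_const hφ j
  simpa [pderiv] using h

lemma exists_isTest_integral_eq_one (d : ℕ) : ∃ ρ : X d → ℝ, IsTest ρ ∧ ∫ x, ρ x = 1 := by
  let b : ContDiffBump (0 : X d) := ⟨1, 2, one_pos, one_lt_two⟩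
  exact ⟨b.normed volume, ⟨b.contDiff_normed, b.hasCompactSupport_normed⟩, b.integral_normed⟩

lemma locallyIntegrable_mul (f : L2per C) {W : X d → ℝ} (hW : Continuous W) :
    LocallyIntegrable (fun x => fn f x * W x) volume :=
  (locallyIntegrable f).mul_continuous hW

lemma periodic_mul (f : L2per C) {W : X d → ℝ} (hW : ∀ y ∈ C.lattice, ∀ x, W (x + y) = W x)
    (y : C.lattice) :
    (fun x => fn f (y +ᵥ x) * W (y +ᵥ x)) =ᵐ[volume] fun x => fn f x * W x := by
  filter_upwards [fn_vadd f y] with x hx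
  rw [hx, AddSubgroup.vadd_def, vadd_eq_add, add_comm, hW y y.2]

lemma isTest_translate_mul {ρ W : X d → ℝ} (hρ : IsTest ρ) (hW : ContDiff ℝ ∞ W) (z : X d) :
    IsTest fun x => ρ (x - z) * W x := by
  refine ⟨(hρ.1.comp (contDiff_id.sub contDiff_const)).mul hW, HasCompactSupport.mul_right ?_⟩
  exact hρ.2.comp_homeomorph (Homeomorph.subRight z)

lemma pderiv_translate_mul {ρ W : X d → ℝ} (hρ : ContDiff ℝ ∞ ρ) (hW : ContDiff ℝ ∞ W)
    (z : X d) (j : Fin d) (x : X d) :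
    pderiv j (fun x => ρ (x - z) * W x) x = pderiv j ρ (x - z) * W x + ρ (x - z) * pderiv j W x := by
  have h1 : DifferentiableAt ℝ (fun x => ρ (x - z)) x :=
    (hρ.differentiable (by simp)).comp (differentiable_id.sub_const z) x
  have h2 : DifferentiableAt ℝ W x := hW.differentiable (by simp) x
  have h3 : fderiv ℝ (fun x => ρ (x - z)) x = fderiv ℝ ρ (x - z) := by
    simpa [sub_eq_add_neg] using fderiv_comp_add_right (f := ρ) (x := x) (-z)
  simp only [pderiv]
  rw [fderiv_fun_mul h1 h2, h3]
  simp only [_root_.add_apply, _root_.smul_apply, smul_eq_mul]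
  ring

lemma pderiv_periodic {W : X d → ℝ} (hW : ∀ y ∈ C.lattice, ∀ x, W (x + y) = W x) (j : Fin d) :
    ∀ y ∈ C.lattice, ∀ x, pderiv j W (x + y) = pderiv j W x := by
  intro y hy x
  rw [pderiv, ← fderiv_comp_add_right y]
  simp only [hW y hy, pderiv]

/-- A distributional divergence may be tested against smooth periodic functions. -/
lemma IsWeakDiv.integral_box {f : Fin d → L2per C} {g : L2per C} (hfg : IsWeakDiv f g)
    {W : X d → ℝ} (hW : ContDiff ℝ ∞ W) (hp : ∀ y ∈ C.lattice, ∀ x, W (x + y) = W x) :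
    ∑ j, ∫ x in C.box, fn (f j) x * pderiv j W x = - ∫ x in C.box, fn g x * W x := by
  obtain ⟨ρ, hρ, hρ1⟩ := exists_isTest_integral_eq_one d
  have hA : ∀ j, _ := fun j => integrableOn_integral_mul_translate
    (locallyIntegrable_mul (f j) hW.continuous) (periodic_mul (f j) hp)
    (continuous_pderiv hρ.1 j) (hρ.hasCompactSupport_pderiv j)
  have hB : ∀ j, _ := fun j => integrableOn_integral_mul_translate
    (locallyIntegrable_mul (f j) (continuous_pderiv hW j))
    (periodic_mul (f j) (pderiv_periodic hp j)) hρ.1.continuous hρ.2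
  have hG := integrableOn_integral_mul_translate
    (locallyIntegrable_mul g hW.continuous) (periodic_mul g hp) hρ.1.continuous hρ.2
  -- The product of `W` with the translated bump `ρ (x - z)` is an admissible test function for
  -- every `z`. After integration over `z` in the cell, the terms with a derivative of `ρ` vanish
  -- because such a derivative has integral zero, and the others keep the factor `∫ ρ = 1`.
  have key : ∀ z, ∑ j, ((∫ x, fn (f j) x * W x * pderiv j ρ (x - z)) +
      ∫ x, fn (f j) x * pderiv j W x * ρ (x - z)) = - ∫ x, fn g x * W x * ρ (x - z) := by
    intro z
    have h1 := hfg _ (isTest_translate_mul hρ hW z)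
    simp only [pderiv_translate_mul hρ.1 hW] at h1
    have hi : ∀ (f : L2per C) {V σ : X d → ℝ}, Continuous V → Continuous σ →
        HasCompactSupport σ → Integrable fun x => fn f x * V x * σ (x - z) :=
      fun f V σ hV hσ hσ' => (locallyIntegrable_mul f hV).integrable_smul_right_of_hasCompactSupport
        (hσ.comp (continuous_id.sub continuous_const)) (hσ'.comp_homeomorph (Homeomorph.subRight z))
    calc _ = ∑ j, ∫ x, fn (f j) x * (pderiv j ρ (x - z) * W x + ρ (x - z) * pderiv j W x) := by
          refine Finset.sum_congr rfl fun j _ => ?_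
          rw [← integral_add (hi (f j) hW.continuous (continuous_pderiv hρ.1 j)
            (hρ.hasCompactSupport_pderiv j))
            (hi (f j) (continuous_pderiv hW j) hρ.1.continuous hρ.2)]
          exact integral_congr_ae (Eventually.of_forall fun x => by ring)
      _ = _ := h1
      _ = _ := by
          congr 1
          exact integral_congr_ae (Eventually.of_forall fun x => by ring)
  have h2 : ∫ z in C.box, ∑ j, ((∫ x, fn (f j) x * W x * pderiv j ρ (x - z)) +
      ∫ x, fn (f j) x * pderiv j W x * ρ (x - z)) =
      ∫ z in C.box, - ∫ x, fn g x * W x * ρ (x - z) := by simp only [key]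
  rw [integral_neg, hG.2, hρ1, mul_one, integral_finsetSum (f := fun j z =>
    (∫ x, fn (f j) x * W x * pderiv j ρ (x - z)) + ∫ x, fn (f j) x * pderiv j W x * ρ (x - z)) _
    fun j _ => (hA j).1.add (hB j).1] at h2
  rw [← h2]
  refine Finset.sum_congr rfl fun j _ => ?_
  rw [integral_add (hA j).1 (hB j).1, (hA j).2, (hB j).2, hρ1, integral_pderiv hρ]
  simp

/-! ### Fourier form of weak derivatives -/

lemma avgMul_eq_box (f g : L2per C) :
    avgMul f g = (volume.real C.V)⁻¹ * ∫ x in C.box, fn f x * fn g x := by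
  rw [avgMul_eq_cellMeasure, integral_smul_measure, ENNReal.toReal_inv, smul_eq_mul]
  rfl

lemma avgMul_ofContinuous (f : L2per C) {W : X d → ℝ} (hc : Continuous W)
    (hp : ∀ y ∈ C.lattice, ∀ x, W (x + y) = W x) :
    avgMul f (ofContinuous C W hc hp) =
      (volume.real C.V)⁻¹ * ∫ x in C.box, fn f x * W x := by
  rw [avgMul_eq_box]
  congr 1
  refine integral_congr_ae (ae_restrict_of_ae ?_)
  filter_upwards [fn_ofContinuous hc hp] with x hx
  rw [hx]

/-- The components of the wave vector of index `k`. -/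
def waveVector (C : UnitCell d) (k : Fin d → ℤ) (j : Fin d) : ℝ :=
  phase C k (EuclideanSpace.single j 1)

lemma contDiff_cos_phase (k : Fin d → ℤ) : ContDiff ℝ ∞ fun x => Real.cos (phase C k x) :=
  Real.contDiff_cos.comp (phase C k).contDiff

lemma contDiff_sin_phase (k : Fin d → ℤ) : ContDiff ℝ ∞ fun x => Real.sin (phase C k x) :=
  Real.contDiff_sin.comp (phase C k).contDiff

lemma pderiv_cos_phase (k : Fin d → ℤ) (j : Fin d) (x : X d) :
    pderiv j (fun x => Real.cos (phase C k x)) x =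
      -(waveVector C k j * Real.sin (phase C k x)) := by
  rw [pderiv, (((phase C k).hasFDerivAt (x := x)).cos).fderiv]
  simp [waveVector, mul_comm]

lemma pderiv_sin_phase (k : Fin d → ℤ) (j : Fin d) (x : X d) :
    pderiv j (fun x => Real.sin (phase C k x)) x =
      waveVector C k j * Real.cos (phase C k x) := by
  rw [pderiv, (((phase C k).hasFDerivAt (x := x)).sin).fderiv]
  simp [waveVector, mul_comm]

/-- The Fourier transform of the relation `div f = g`. -/
def IsFourierDiv (f : Fin d → L2per C) (g : L2per C) : Prop :=
  ∀ k, avgMul g (cosMode C k) = ∑ j, waveVector C k j * avgMul (f j) (sinMode C k) ∧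
    avgMul g (sinMode C k) = - ∑ j, waveVector C k j * avgMul (f j) (cosMode C k)

lemma IsWeakDiv.isFourierDiv {f : Fin d → L2per C} {g : L2per C} (hfg : IsWeakDiv f g) :
    IsFourierDiv f g := by
  intro k
  have h1 := hfg.integral_box (contDiff_cos_phase k) (cos_phase_add C k)
  have h2 := hfg.integral_box (contDiff_sin_phase k) (sin_phase_add C k)
  simp only [cosMode, sinMode, avgMul_ofContinuous]
  simp only [pderiv_cos_phase, pderiv_sin_phase, mul_neg, integral_neg,
    mul_left_comm _ (waveVector C k _), integral_const_mul, Finset.sum_neg_distrib] at h1 h2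
  simp only [mul_left_comm (waveVector C k _), ← Finset.mul_sum, h2, neg_inj.1 h1]
  simp

/-! ### Periodization of test functions and the converse -/

lemma volume_real_pos (C : UnitCell d) : 0 < volume.real C.V :=
  ENNReal.toReal_pos C.volume_ne_zero C.volume_ne_top

lemma exists_setIntegral_sq_le (C : UnitCell d) {K : Set (X d)} (hK : IsCompact K) :
    ∃ M : ℝ, 0 ≤ M ∧ ∀ f : L2per C, ∫ x in K, fn f x * fn f x ≤ M * avgMul f f := by
  obtain ⟨N, hN⟩ := exists_setLIntegral_compact_le C hK
  refine ⟨N * volume.real C.V, by positivity, fun f => ?_⟩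
  have h1 : IntegrableOn (fun x => fn f x * fn f x) K :=
    (f.2.1 K hK).integrable_mul (f.2.1 K hK)
  have h2 : IntegrableOn (fun x => fn f x * fn f x) C.box :=
    (memLp_box f).integrable_mul (memLp_box f)
  have h3 := hN (fun x => ENNReal.ofReal (fn f x * fn f x)) fun y => by
    filter_upwards [fn_vadd f y] with x hx
    rw [hx]
  rw [avgMul_eq_box, mul_assoc, mul_inv_cancel_left₀ (volume_real_pos C).ne']
  rw [← ofReal_integral_eq_lintegral_ofReal h1 (Eventually.of_forall fun x => mul_self_nonneg _),
    ← ofReal_integral_eq_lintegral_ofReal h2 (Eventually.of_forall fun x => mul_self_nonneg _),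
    ← ENNReal.ofReal_natCast, ← ENNReal.ofReal_mul (by positivity)] at h3
  exact (ENNReal.ofReal_le_ofReal_iff (mul_nonneg (by positivity)
    (integral_nonneg fun x => mul_self_nonneg _))).1 h3

/-- The pointwise bound of `|f φ|` by `f² + φ²` replaces Cauchy–Schwarz; homogeneity recovers a
linear bound in `abs_le_of_quadratic_growth`. -/
lemma exists_abs_integral_mul_le (C : UnitCell d) {φ : X d → ℝ} (hφ : Continuous φ)
    (hφ' : HasCompactSupport φ) :
    ∃ A B : ℝ, ∀ f : L2per C, |∫ x, fn f x * φ x| ≤ A * avgMul f f + B := by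
  obtain ⟨M, -, hM⟩ := exists_setIntegral_sq_le C hφ'.isCompact
  refine ⟨M, ∫ x in tsupport φ, φ x * φ x, fun f => ?_⟩
  have h1 : ∫ x, fn f x * φ x = ∫ x in tsupport φ, fn f x * φ x := by
    refine (setIntegral_eq_integral_of_forall_compl_eq_zero fun x hx => ?_).symm
    rw [image_eq_zero_of_notMem_tsupport hx, mul_zero]
  have h2 : IntegrableOn (fun x => fn f x * fn f x) (tsupport φ) :=
    (f.2.1 _ hφ'.isCompact).integrable_mul (f.2.1 _ hφ'.isCompact)
  have h3 : IntegrableOn (fun x => φ x * φ x) (tsupport φ) :=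
    (hφ.mul hφ).continuousOn.integrableOn_compact hφ'.isCompact
  rw [h1]
  refine (abs_integral_le_integral_abs).trans ?_
  refine le_trans ?_ (add_le_add_left (hM f) _)
  rw [← integral_add h2 h3]
  refine integral_mono_of_nonneg (Eventually.of_forall fun x => abs_nonneg _) (h2.add h3)
    (Eventually.of_forall fun x => ?_)
  beta_reduce
  rw [abs_le]
  constructor <;> nlinarith [sq_nonneg (fn f x + φ x), sq_nonneg (fn f x - φ x),
    sq_nonneg (fn f x), sq_nonneg (φ x)]

/-- A linear functional on a normed space with quadratic growth is bounded. -/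
lemma abs_le_of_quadratic_growth {E : Type*} [NormedAddCommGroup E] [NormedSpace ℝ E]
    (l : E →ₗ[ℝ] ℝ) {A B : ℝ} (h : ∀ x, |l x| ≤ A * ‖x‖ ^ 2 + B) (x : E) :
    ‖l x‖ ≤ (A + B) * ‖x‖ := by
  rcases eq_or_ne x 0 with rfl | hx
  · simp
  · have hn : 0 < ‖x‖ := norm_pos_iff.2 hx
    have h1 := h (‖x‖⁻¹ • x)
    rw [map_smul, norm_smul, norm_inv, norm_norm, inv_mul_cancel₀ hn.ne', smul_eq_mul, abs_mul,
      abs_of_pos (inv_pos.2 hn), inv_mul_le_iff₀ hn] at h1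
    rw [Real.norm_eq_abs]
    linarith

/-- The functional `f ↦ ∫ f φ` on `L²_per(V)` is represented by the periodization of `φ`. -/
lemma exists_periodization (C : UnitCell d) {φ : X d → ℝ} (hφ : Continuous φ)
    (hφ' : HasCompactSupport φ) :
    ∃ Φ : L2per C, ∀ f : L2per C, avgMul f Φ = ∫ x, fn f x * φ x := by
  obtain ⟨A, B, hAB⟩ := exists_abs_integral_mul_le C hφ hφ'
  have hi : ∀ f : L2per C, Integrable fun x => fn f x * φ x := fun f =>
    (locallyIntegrable f).integrable_smul_right_of_hasCompactSupport hφ hφ'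
  let l : TorusL2 d →ₗ[ℝ] ℝ :=
    { toFun := fun F => ∫ x, fn ((toTorusL2 C).symm F) x * φ x
      map_add' := fun F G => by rw [map_add, integral_add_mul (hi _) (hi _)]
      map_smul' := fun c F => by rw [map_smul, integral_smul_mul]; rfl }
  have hl : ∀ F, ‖l F‖ ≤ (A + B) * ‖F‖ := abs_le_of_quadratic_growth l fun F => by
    have h1 := hAB ((toTorusL2 C).symm F)
    rwa [← norm_toTorusL2_sq, LinearEquiv.apply_symm_apply] at h1
  -- The periodization is the Riesz representer of the bounded functional `l`, so no sum over
  -- lattice translates has to be handled.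
  refine ⟨(toTorusL2 C).symm ((InnerProductSpace.toDual ℝ _).symm (l.mkContinuous (A + B) hl)),
    fun f => ?_⟩
  rw [avgMul_comm, ← inner_toTorusL2, LinearEquiv.apply_symm_apply,
    InnerProductSpace.toDual_symm_apply, LinearMap.mkContinuous_apply]
  change ∫ x, fn ((toTorusL2 C).symm (toTorusL2 C f)) x * φ x = _
  rw [LinearEquiv.symm_apply_apply]

lemma integral_cosMode_mul (φ : X d → ℝ) (k : Fin d → ℤ) :
    ∫ x, fn (cosMode C k) x * φ x = ∫ x, Real.cos (phase C k x) * φ x := by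
  refine integral_congr_ae ?_
  filter_upwards [fn_cosMode k] with x hx
  rw [hx]

lemma integral_sinMode_mul (φ : X d → ℝ) (k : Fin d → ℤ) :
    ∫ x, fn (sinMode C k) x * φ x = ∫ x, Real.sin (phase C k x) * φ x := by
  refine integral_congr_ae ?_
  filter_upwards [fn_sinMode k] with x hx
  rw [hx]

/-- The Fourier transform of the relation `∂_j f = g`. -/
def IsFourierPartial (j : Fin d) (f g : L2per C) : Prop :=
  ∀ k, avgMul g (cosMode C k) = waveVector C k j * avgMul f (sinMode C k) ∧
    avgMul g (sinMode C k) = - (waveVector C k j * avgMul f (cosMode C k))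

/-- Pairing a periodization with a plane wave gives the integral over the whole space of the wave
against `φ` or its derivative, where the classical integration by parts applies. -/
lemma isFourierPartial_periodization {φ : X d → ℝ} (hφ : IsTest φ) (j : Fin d)
    {Φ Φj : L2per C} (h : ∀ f : L2per C, avgMul f Φ = ∫ x, fn f x * φ x)
    (hj : ∀ f : L2per C, avgMul f Φj = ∫ x, fn f x * pderiv j φ x) :
    IsFourierPartial j Φ Φj := by
  intro k
  rw [avgMul_comm Φj, avgMul_comm Φj, avgMul_comm Φ, avgMul_comm Φ, h, h, hj, hj,
    integral_cosMode_mul, integral_cosMode_mul, integral_sinMode_mul, integral_sinMode_mul,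
    integral_mul_pderiv (contDiff_cos_phase k) hφ, integral_mul_pderiv (contDiff_sin_phase k) hφ]
  simp only [pderiv_cos_phase, pderiv_sin_phase, neg_mul, integral_neg, mul_assoc,
    integral_const_mul, neg_neg, and_self]

/-- Integration by parts over the cell, in Fourier variables. -/
lemma IsFourierDiv.sum_avgMul {f : Fin d → L2per C} {g : L2per C} (hfg : IsFourierDiv f g)
    {w : L2per C} {G : Fin d → L2per C} (hw : ∀ j, IsFourierPartial j w (G j)) :
    ∑ j, avgMul (f j) (G j) = - avgMul g w := by
  have h1 := hasSum_sum fun j (_ : j ∈ Finset.univ) => hasSum_avgMul (f j) (G j)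
  -- Parseval expands both sides into series over the wave vectors, and these agree term by term.
  refine h1.unique ((hasSum_avgMul g w).neg.congr_fun fun k => ?_)
  rw [(hfg k).1, (hfg k).2]
  simp only [(hw _ k).1, (hw _ k).2, neg_mul, Finset.sum_mul]
  rw [← sub_eq_add_neg, neg_sub, ← Finset.sum_sub_distrib]
  refine Finset.sum_congr rfl fun j _ => ?_
  ring

/-- Testing a periodic field against `φ` is the same as pairing it with the periodization of `φ`, so
the distributional identity becomes the Fourier integration by parts. -/
lemma IsFourierDiv.isWeakDiv {f : Fin d → L2per C} {g : L2per C} (hfg : IsFourierDiv f g) :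
    IsWeakDiv f g := by
  intro φ hφ
  obtain ⟨Φ, hΦ⟩ := exists_periodization C hφ.1.continuous hφ.2
  choose Ψ hΨ using fun j => exists_periodization C (continuous_pderiv hφ.1 j)
    (hφ.hasCompactSupport_pderiv j)
  simp only [← hΦ, ← hΨ]
  exact hfg.sum_avgMul fun j => isFourierPartial_periodization hφ j hΦ (hΨ j)

lemma isWeakDiv_iff {f : Fin d → L2per C} {g : L2per C} : IsWeakDiv f g ↔ IsFourierDiv f g :=
  ⟨IsWeakDiv.isFourierDiv, IsFourierDiv.isWeakDiv⟩

/-- A partial derivative is the divergence of a vector field with a single nonzero component, so the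
divergence case suffices. -/
lemma isWeakPartial_iff {j : Fin d} {f g : L2per C} :
    IsWeakPartial j f g ↔ IsFourierPartial j f g := by
  have h1 : IsWeakPartial j f g ↔ IsWeakDiv (Pi.single j f) g := by
    refine forall_congr' fun φ => imp_congr_right fun hφ => ?_
    rw [Finset.sum_eq_single j (fun i _ hi => by rw [Pi.single_eq_of_ne hi, integral_zero_mul])
      (by simp), Pi.single_eq_same]
  have h2 : IsFourierPartial j f g ↔ IsFourierDiv (Pi.single j f) g := by
    refine forall_congr' fun k => ?_
    rw [Finset.sum_eq_single j (fun i _ hi => by rw [Pi.single_eq_of_ne hi]; simp) (by simp),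
      Finset.sum_eq_single j (fun i _ hi => by rw [Pi.single_eq_of_ne hi]; simp) (by simp),
      Pi.single_eq_same]
  rw [h1, h2, isWeakDiv_iff]

/-! ### Coercivity of the stiffness and completeness of the strain space -/

lemma isClosed_symmetric {E : Type*} [TopologicalSpace E] [T2Space E] :
    IsClosed {F : Fin d → Fin d → E | ∀ i j, F i j = F j i} := by
  simp only [Set.ofPred_forall]
  exact isClosed_iInter fun i => isClosed_iInter fun j =>
    isClosed_eq (by fun_prop) (by fun_prop)

lemma ElasticityTensor.density_smul (L : ElasticityTensor d) (t : ℝ) (e : Fin d → Fin d → ℝ) :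
    L.density (t • e) = t ^ 2 * L.density e := by
  simp only [ElasticityTensor.density, Pi.smul_apply, smul_eq_mul, Finset.mul_sum, Finset.sum_mul]
  refine Finset.sum_congr rfl fun i _ => Finset.sum_congr rfl fun j _ =>
    Finset.sum_congr rfl fun k _ => Finset.sum_congr rfl fun l _ => ?_
  ring

/-- Positive definiteness on symmetric tensors is uniform. -/
lemma ElasticityTensor.exists_coercive (L : ElasticityTensor d) :
    ∃ c : ℝ, 0 < c ∧ ∀ e : Fin d → Fin d → ℝ, (∀ i j, e i j = e j i) →
      c * ∑ i, ∑ j, e i j * e i j ≤ L.density e := by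
  have hcont : Continuous fun e : Fin d → Fin d → ℝ => ∑ i, ∑ j, e i j * e i j := by fun_prop
  have hle : ∀ (e : Fin d → Fin d → ℝ) (i j : Fin d), e i j * e i j ≤ ∑ i, ∑ j, e i j * e i j :=
    fun e i j => (Finset.single_le_sum (f := fun j => e i j * e i j)
      (fun j _ => mul_self_nonneg _) (Finset.mem_univ j)).trans
      (Finset.single_le_sum (f := fun i => ∑ j, e i j * e i j)
        (fun i _ => Finset.sum_nonneg fun j _ => mul_self_nonneg _) (Finset.mem_univ i))
  let K : Set (Fin d → Fin d → ℝ) :=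
    {e | (∀ i j, e i j = e j i) ∧ ∑ i, ∑ j, e i j * e i j = 1}
  have hK : IsCompact K := by
    refine (isCompact_closedBall (0 : Fin d → Fin d → ℝ) 1).of_isClosed_subset ?_ ?_
    · refine IsClosed.inter ?_ (isClosed_eq hcont continuous_const)
      exact isClosed_symmetric
    · intro e he
      rw [mem_closedBall_zero_iff, pi_norm_le_iff_of_nonneg zero_le_one]
      intro i
      rw [pi_norm_le_iff_of_nonneg zero_le_one]
      intro j
      have h1 := hle e i j
      rw [he.2] at h1
      exact abs_le_one_iff_mul_self_le_one.2 h1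
  have hdens : Continuous L.density := by
    unfold ElasticityTensor.density
    fun_prop
  -- A lower bound on the unit sphere `K` extends to all symmetric tensors because the density is
  -- quadratic; the best such bound is then the minimum over the compact set `K`.
  have hscale : ∀ c : ℝ, (∀ e ∈ K, c ≤ L.density e) → ∀ e : Fin d → Fin d → ℝ,
      (∀ i j, e i j = e j i) → c * ∑ i, ∑ j, e i j * e i j ≤ L.density e := by
    intro c hc e he
    rcases (Finset.sum_nonneg fun i _ => Finset.sum_nonneg fun j _ =>
      mul_self_nonneg (e i j) : 0 ≤ ∑ i, ∑ j, e i j * e i j).eq_or_lt with h0 | h0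
    · rw [← h0, mul_zero]
      exact density_nonneg L e he
    · set s := ∑ i, ∑ j, e i j * e i j with hs
      have hsq : (Real.sqrt s)⁻¹ ^ 2 = s⁻¹ := by rw [inv_pow, Real.sq_sqrt h0.le]
      have h1 : (Real.sqrt s)⁻¹ • e ∈ K := by
        refine ⟨fun i j => by simp [he i j], ?_⟩
        have h2 : ∀ i j, ((Real.sqrt s)⁻¹ • e) i j * ((Real.sqrt s)⁻¹ • e) i j =
            s⁻¹ * (e i j * e i j) := fun i j => by
          rw [← hsq]
          simp only [Pi.smul_apply, smul_eq_mul]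
          ring
        simp only [h2, ← Finset.mul_sum]
        exact inv_mul_cancel₀ h0.ne'
      have h3 := hc _ h1
      rw [L.density_smul, hsq] at h3
      rwa [mul_comm, ← le_inv_mul_iff₀ h0]
  rcases K.eq_empty_or_nonempty with hE | hN
  -- The sphere is empty only for `d = 0`, where any positive constant serves.
  · exact ⟨1, one_pos, hscale 1 fun e he => by simp [hE] at he⟩
  · obtain ⟨e, he, hmin⟩ := hK.exists_isMinOn hN hdens.continuousOn
    refine ⟨L.density e, L.pos e he.1 fun h0 => ?_, hscale _ fun f hf => hmin hf⟩
    have := he.2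
    simp [h0] at this

lemma norm_sq_eq_energetic {L : ElasticityTensor d} (η : He C L) :
    ‖η‖ ^ 2 = energetic L η.field η.field := by
  rw [← real_inner_self_eq_norm_sq, inner_eq_energetic]

lemma duality_self (η : SymL2per C) : duality η η =
    (volume.real C.V)⁻¹ * ∫ x in C.V, ∑ i, ∑ j, comp η i j x * comp η i j x := by
  rw [duality, cellAverage, setAverage_eq, smul_eq_mul]

lemma energetic_self_eq_integral (L : ElasticityTensor d) (η : SymL2per C) : energetic L η η =
    (volume.real C.V)⁻¹ * ∫ x in C.V, L.density fun i j => comp η i j x := by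
  rw [energetic_self, cellAverage, setAverage_eq, smul_eq_mul]

lemma integrable_sum_comp_sq (η : SymL2per C) :
    Integrable (fun x => ∑ i, ∑ j, comp η i j x * comp η i j x) (volume.restrict C.V) :=
  integrable_finsetSum _ fun i _ => integrable_finsetSum _ fun j _ =>
    integrable_mul_cell (η.1 i j) (η.1 i j)

lemma exists_duality_le_energetic (C : UnitCell d) (L : ElasticityTensor d) :
    ∃ c : ℝ, 0 < c ∧ ∀ η : SymL2per C, c * duality η η ≤ energetic L η η := by
  obtain ⟨c, hc, h⟩ := L.exists_coercive
  refine ⟨c, hc, fun η => ?_⟩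
  rw [duality_self, energetic_self_eq_integral, mul_left_comm, ← integral_const_mul]
  refine mul_le_mul_of_nonneg_left ?_ (inv_nonneg.2 (volume_real_pos C).le)
  exact integral_mono ((integrable_sum_comp_sq η).const_mul c) (integrable_density L η)
    fun x => h (fun i j => comp η i j x) fun i j => comp_symm η i j x

lemma exists_duality_le_norm_sq (C : UnitCell d) (L : ElasticityTensor d) :
    ∃ c : ℝ, 0 < c ∧ ∀ η : He C L, c * duality η.field η.field ≤ ‖η‖ ^ 2 := by
  obtain ⟨c, hc, h⟩ := exists_duality_le_energetic C L
  exact ⟨c, hc, fun η => (h η.field).trans_eq (norm_sq_eq_energetic η).symm⟩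

lemma avgMul_self_nonneg (f : L2per C) : 0 ≤ avgMul f f := by
  rw [← norm_toTorusL2_sq]
  positivity

lemma avgMul_self_le_duality (η : SymL2per C) (i j : Fin d) :
    avgMul (η.1 i j) (η.1 i j) ≤ duality η η := by
  rw [duality_eq_sum]
  exact (Finset.single_le_sum (f := fun j => avgMul (η.1 i j) (η.1 i j))
    (fun j _ => avgMul_self_nonneg _) (Finset.mem_univ j)).trans
    (Finset.single_le_sum (f := fun i => ∑ j, avgMul (η.1 i j) (η.1 i j))
      (fun i _ => Finset.sum_nonneg fun j _ => avgMul_self_nonneg _) (Finset.mem_univ i))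

/-- The components of a strain field, as functions on the torus. -/
def components (C : UnitCell d) (L : ElasticityTensor d) :
    He C L →ₗ[ℝ] Fin d → Fin d → TorusL2 d where
  toFun η i j := toTorusL2 C (η.field.1 i j)
  map_add' η ζ := by
    funext i j
    simp
  map_smul' c η := by
    funext i j
    simp

/-- Coercivity gives this half of the equivalence between the energetic and `L²` norms. -/
lemma exists_norm_components_le (C : UnitCell d) (L : ElasticityTensor d) :
    ∃ K : ℝ, 0 ≤ K ∧ ∀ η : He C L, ‖components C L η‖ ≤ K * ‖η‖ := by
  obtain ⟨c, hc, h⟩ := exists_duality_le_norm_sq C L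
  refine ⟨Real.sqrt c⁻¹, Real.sqrt_nonneg _, fun η => ?_⟩
  have hK : 0 ≤ Real.sqrt c⁻¹ * ‖η‖ := by positivity
  refine (pi_norm_le_iff_of_nonneg hK).2 fun i => (pi_norm_le_iff_of_nonneg hK).2 fun j => ?_
  refine le_of_sq_le_sq ?_ hK
  rw [mul_pow, Real.sq_sqrt (inv_nonneg.2 hc.le)]
  refine (norm_toTorusL2_sq _).trans_le ((avgMul_self_le_duality _ i j).trans ?_)
  rw [le_inv_mul_iff₀ hc]
  exact h η

/-- The other half follows from Cauchy–Schwarz on each term of the energy; the constant collects the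
absolute values of all the coefficients. -/
lemma exists_norm_le_components (C : UnitCell d) (L : ElasticityTensor d) :
    ∃ K : ℝ, 0 ≤ K ∧ ∀ η : He C L, ‖η‖ ≤ K * ‖components C L η‖ := by
  refine ⟨Real.sqrt (∑ i, ∑ j, ∑ k, ∑ l, |L.coeff i j k l|), Real.sqrt_nonneg _, fun η => ?_⟩
  refine le_of_sq_le_sq ?_ (by positivity)
  rw [mul_pow, Real.sq_sqrt (by positivity), norm_sq_eq_energetic, energetic_eq_sum]
  simp only [Finset.sum_mul]
  refine Finset.sum_le_sum fun i _ => Finset.sum_le_sum fun j _ =>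
    Finset.sum_le_sum fun k _ => Finset.sum_le_sum fun l _ => ?_
  refine (le_abs_self _).trans ?_
  rw [abs_mul, ← inner_toTorusL2, pow_two]
  refine mul_le_mul_of_nonneg_left ((abs_real_inner_le_norm _ _).trans ?_) (abs_nonneg _)
  have h : ∀ i j, ‖toTorusL2 C (η.field.1 i j)‖ ≤ ‖components C L η‖ := fun i j =>
    (norm_le_pi_norm (components C L η i) j).trans (norm_le_pi_norm (components C L η) i)
  exact mul_le_mul (h k l) (h i j) (norm_nonneg _) (norm_nonneg _)

/-- A linear map which is bounded from above and below is a uniform embedding. -/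
lemma uniformContinuous_antilipschitz_of_bounds {E F : Type*} [NormedAddCommGroup E]
    [NormedSpace ℝ E] [NormedAddCommGroup F] [NormedSpace ℝ F] (T : E →ₗ[ℝ] F)
    (h1 : ∃ K : ℝ, 0 ≤ K ∧ ∀ x, ‖T x‖ ≤ K * ‖x‖) (h2 : ∃ K : ℝ, 0 ≤ K ∧ ∀ x, ‖x‖ ≤ K * ‖T x‖) :
    UniformContinuous T ∧ ∃ K, AntilipschitzWith K T := by
  obtain ⟨K, -, hK⟩ := h1
  obtain ⟨K', hK0, hK'⟩ := h2
  exact ⟨(T.mkContinuous K hK).uniformContinuous,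
    ⟨K', hK0⟩, AddMonoidHomClass.antilipschitz_of_bound T hK'⟩

/-- The strain field with the given symmetric components. -/
def ofComponents (C : UnitCell d) (L : ElasticityTensor d) (F : Fin d → Fin d → TorusL2 d)
    (hF : ∀ i j, F i j = F j i) : He C L :=
  He.field.symm ⟨fun i j => (toTorusL2 C).symm (F i j), fun i j => congrArg _ (hF i j)⟩

lemma components_ofComponents (L : ElasticityTensor d) {F : Fin d → Fin d → TorusL2 d}
    (hF : ∀ i j, F i j = F j i) : components C L (ofComponents C L F hF) = F := by
  funext i j
  exact (toTorusL2 C).apply_symm_apply (F i j)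

/-- By the two norm bounds the components embed the space uniformly into a complete product, and the
range is the closed set of symmetric families. -/
lemma completeSpace_he (C : UnitCell d) (L : ElasticityTensor d) : CompleteSpace (He C L) := by
  obtain ⟨h1, K, h2⟩ := uniformContinuous_antilipschitz_of_bounds (components C L)
    (exists_norm_components_le C L) (exists_norm_le_components C L)
  rw [completeSpace_iff_isComplete_range (h2.isUniformInducing h1)]
  refine IsClosed.isComplete ?_
  have h3 : range (components C L) = {F | ∀ i j, F i j = F j i} := by
    ext F
    refine ⟨?_, fun hF => ⟨_, components_ofComponents L hF⟩⟩
    rintro ⟨η, rfl⟩ i j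
    exact congrArg (toTorusL2 C) (η.field.2 i j)
  rw [h3]
  exact isClosed_symmetric

/-! ### Korn and Poincaré inequalities -/

lemma phase_period (C : UnitCell d) (k : Fin d → ℤ) (i : Fin d) :
    phase C k (C.Y i) = 2 * Real.pi * k i := by
  rw [phase_apply, Finset.sum_eq_single i]
  · simp
  · intro j _ hj
    simp [Finsupp.single_eq_of_ne hj]
  · simp

lemma phase_eq_sum (C : UnitCell d) (k : Fin d → ℤ) (x : X d) :
    phase C k x = ∑ j, waveVector C k j * x j := by
  conv_lhs => rw [← (EuclideanSpace.basisFun (Fin d) ℝ).sum_repr x]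
  simp [waveVector, mul_comm]

/-- Nonzero wave vectors are bounded away from zero. -/
lemma one_le_sum_waveVector_sq (C : UnitCell d) {k : Fin d → ℤ} (hk : k ≠ 0) :
    1 ≤ (∑ i, ‖C.Y i‖ ^ 2) * ∑ j, waveVector C k j ^ 2 := by
  -- For an index with `k i ≠ 0`, the phase at the period `C.Y i` is `2π k i`, of absolute value at
  -- least 1. It is also the scalar product of the wave vector with that period, so Cauchy–Schwarz
  -- concludes.
  obtain ⟨i, hi⟩ := Function.ne_iff.1 hk
  have h1 : (1 : ℝ) ≤ (2 * Real.pi * k i) ^ 2 := by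
    have h2 : (1 : ℝ) ≤ (k i : ℝ) ^ 2 := by
      have : 1 ≤ (k i) ^ 2 :=
        Int.add_one_le_iff.2 (sq_pos_of_ne_zero hi)
      exact_mod_cast this
    have h3 : (1 : ℝ) ≤ (2 * Real.pi) ^ 2 := by nlinarith [Real.pi_gt_three]
    rw [mul_pow]
    nlinarith
  refine h1.trans ?_
  rw [← phase_period, phase_eq_sum]
  refine (Finset.sum_mul_sq_le_sq_mul_sq _ _ _).trans ?_
  rw [mul_comm]
  refine mul_le_mul_of_nonneg_right ?_ (Finset.sum_nonneg fun j _ => sq_nonneg _)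
  rw [← EuclideanSpace.real_norm_sq_eq]
  exact Finset.single_le_sum (f := fun i => ‖C.Y i‖ ^ 2) (fun i _ => sq_nonneg _)
    (Finset.mem_univ i)

lemma sinMode_zero (C : UnitCell d) : sinMode C 0 = 0 := by
  refine ext_ae ((fn_sinMode 0).trans (EventuallyEq.trans ?_ fn_zero.symm))
  exact Eventually.of_forall fun x => by simp [phase_apply]

lemma fn_cosMode_zero (C : UnitCell d) : fn (cosMode C 0) =ᵐ[volume] fun _ => (1 : ℝ) :=
  (fn_cosMode 0).trans (Eventually.of_forall fun x => by simp [phase_apply])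

lemma avgMul_cosMode_zero (f : L2per C) : avgMul f (cosMode C 0) = cellAverage C (fn f) := by
  rw [avgMul, LinearMap.mk₂_apply, cellAverage, cellAverage, setAverage_eq, setAverage_eq]
  congr 1
  refine integral_congr_ae (ae_restrict_of_ae ?_)
  filter_upwards [fn_cosMode_zero C] with x hx
  rw [hx, mul_one]

lemma avgMul_cosMode_zero_self (C : UnitCell d) : avgMul (cosMode C 0) (cosMode C 0) = 1 := by
  rw [avgMul_cosMode_zero, cellAverage, setAverage_eq,
    integral_congr_ae (ae_restrict_of_ae (fn_cosMode_zero C))]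
  simp [(volume_real_pos C).ne']

lemma isWeakPartial_cosMode_zero (C : UnitCell d) (j : Fin d) :
    IsWeakPartial j (cosMode C 0) 0 := by
  intro φ hφ
  rw [integral_zero_mul, neg_zero, ← integral_pderiv hφ j]
  refine integral_congr_ae ?_
  filter_upwards [fn_cosMode_zero C] with x hx
  rw [hx, one_mul]

/-- **Korn's inequality** for one Fourier mode. -/
lemma sum_sq_le_two_mul_sum_sym_sq (a b : Fin d → ℝ) :
    ∑ i, ∑ j, (a j * b i) ^ 2 ≤ 2 * ∑ i, ∑ j, (1 / 2 * (a j * b i + a i * b j)) ^ 2 := by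
  have h1 : ∀ i j, (1 / 2 * (a j * b i + a i * b j)) ^ 2 =
      1 / 4 * (a j * b i) ^ 2 + 1 / 4 * (a i * b j) ^ 2 + 1 / 2 * ((a i * b i) * (a j * b j)) :=
    fun i j => by ring
  have h2 : ∑ i, ∑ j, (a i * b j) ^ 2 = ∑ i, ∑ j, (a j * b i) ^ 2 := Finset.sum_comm
  -- The cross terms add up to the square of `∑ i, a i * b i`, which is nonnegative and can be
  -- dropped; the remaining squares give exactly the left side, hence the constant 2.
  have h3 : ∑ i, ∑ j, (a i * b i) * (a j * b j) = (∑ i, a i * b i) * ∑ j, a j * b j :=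
    (Finset.sum_mul_sum _ _ _ _).symm
  simp only [h1, Finset.sum_add_distrib, ← Finset.mul_sum, h2]
  simp only [← Finset.mul_sum] at h3
  rw [h3]
  nlinarith [mul_self_nonneg (∑ i, a i * b i)]

lemma hasSum_sum_avgMul_self (G : Fin d → Fin d → L2per C) :
    HasSum (fun k => ∑ i, ∑ j, (avgMul (G i j) (cosMode C k) ^ 2 +
      avgMul (G i j) (sinMode C k) ^ 2)) (∑ i, ∑ j, avgMul (G i j) (G i j)) := by
  simp only [pow_two]
  exact hasSum_sum fun i _ => hasSum_sum fun j _ => hasSum_avgMul (G i j) (G i j)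

/-- **Korn's inequality** for periodic fields. -/
lemma korn {w : Fin d → L2per C} {G : Fin d → Fin d → L2per C} (h : IsH1Gradient w G) :
    ∑ i, ∑ j, avgMul (G i j) (G i j) ≤
      2 * ∑ i, ∑ j, avgMul ((1 / 2 : ℝ) • (G i j + G j i)) ((1 / 2 : ℝ) • (G i j + G j i)) := by
  refine hasSum_le (fun k => ?_) (hasSum_sum_avgMul_self G)
    ((hasSum_sum_avgMul_self fun i j => (1 / 2 : ℝ) • (G i j + G j i)).mul_left 2)
  have hF : ∀ i j, _ := fun i j => isWeakPartial_iff.1 (h i j) k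
  -- The cosine coefficients of the gradient are wave vector times sine coefficients of `w`, and its
  -- sine coefficients are minus wave vector times cosine coefficients; each family is treated as
  -- one mode.
  have h1 := sum_sq_le_two_mul_sum_sym_sq (waveVector C k) fun i => avgMul (w i) (sinMode C k)
  have h2 := sum_sq_le_two_mul_sum_sym_sq (waveVector C k) fun i => - avgMul (w i) (cosMode C k)
  simp only [map_smul, map_add, LinearMap.smul_apply, LinearMap.add_apply, smul_eq_mul,
    (hF _ _).1, (hF _ _).2, Finset.sum_add_distrib, mul_add (2 : ℝ)]
  simp only [mul_neg] at h2
  exact add_le_add h1 h2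

/-- **Poincaré's inequality** for periodic functions with zero mean. -/
lemma poincare {w : L2per C} {G : Fin d → L2per C} (h : ∀ j, IsWeakPartial j w (G j))
    (h0 : avgMul w (cosMode C 0) = 0) :
    avgMul w w ≤ (∑ i, ‖C.Y i‖ ^ 2) * ∑ j, avgMul (G j) (G j) := by
  refine hasSum_le (fun k => ?_) (hasSum_avgMul w w)
    ((hasSum_sum fun j _ => hasSum_avgMul (G j) (G j)).mul_left _)
  have hF : ∀ j, _ := fun j => isWeakPartial_iff.1 (h j) k
  rcases eq_or_ne k 0 with rfl | hk
  · rw [h0, sinMode_zero, map_zero]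
    simp only [mul_zero, add_zero, map_zero]
    exact mul_nonneg (by positivity) (Finset.sum_nonneg fun j _ => mul_self_nonneg _)
  · have h1 := mul_le_mul_of_nonneg_right (one_le_sum_waveVector_sq C hk)
      (add_nonneg (mul_self_nonneg (avgMul w (cosMode C k)))
        (mul_self_nonneg (avgMul w (sinMode C k))))
    rw [one_mul, mul_assoc, Finset.sum_mul (f := fun j => waveVector C k j ^ 2)] at h1
    refine h1.trans_eq (congrArg _ (Finset.sum_congr rfl fun j _ => ?_))
    rw [(hF j).1, (hF j).2]
    ring

/-! ### Closedness of the compatible strains -/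

/-- Mean-free periodic displacement fields in `H¹_per(V)`, together with their gradients. -/
def displacements (C : UnitCell d) :
    Submodule ℝ ((Fin d → TorusL2 d) × (Fin d → Fin d → TorusL2 d)) where
  carrier := {p | (∀ i j k,
      inner ℝ (p.2 i j) (toTorusL2 C (cosMode C k)) =
        waveVector C k j * inner ℝ (p.1 i) (toTorusL2 C (sinMode C k)) ∧
      inner ℝ (p.2 i j) (toTorusL2 C (sinMode C k)) =
        - (waveVector C k j * inner ℝ (p.1 i) (toTorusL2 C (cosMode C k)))) ∧
    ∀ i, inner ℝ (p.1 i) (toTorusL2 C (cosMode C 0)) = 0}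
  add_mem' := by
    rintro p q ⟨hp, hp'⟩ ⟨hq, hq'⟩
    refine ⟨fun i j k => ⟨?_, ?_⟩, fun i => ?_⟩
    · simp only [Prod.fst_add, Prod.snd_add, Pi.add_apply, inner_add_left, (hp i j k).1,
        (hq i j k).1]
      ring
    · simp only [Prod.fst_add, Prod.snd_add, Pi.add_apply, inner_add_left, (hp i j k).2,
        (hq i j k).2]
      ring
    · simp only [Prod.fst_add, Pi.add_apply, inner_add_left, hp', hq', add_zero]
  zero_mem' := by
    simp
  smul_mem' := by
    rintro c p ⟨hp, hp'⟩
    refine ⟨fun i j k => ⟨?_, ?_⟩, fun i => ?_⟩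
    · simp only [Prod.smul_fst, Prod.smul_snd, Pi.smul_apply, real_inner_smul_left, (hp i j k).1]
      ring
    · simp only [Prod.smul_fst, Prod.smul_snd, Pi.smul_apply, real_inner_smul_left, (hp i j k).2]
      ring
    · simp only [Prod.smul_fst, Pi.smul_apply, real_inner_smul_left, hp', mul_zero]

/-- In Fourier form each condition equates two continuous functions of the displacement and its
gradient, so closedness is immediate. -/
lemma isClosed_displacements (C : UnitCell d) : 
    IsClosed (displacements C : Set ((Fin d → TorusL2 d) × (Fin d → Fin d → TorusL2 d))) := by
  change IsClosed {p : (Fin d → TorusL2 d) × (Fin d → Fin d → TorusL2 d) |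
    (∀ i j k, _ ∧ _) ∧ ∀ i, _}
  simp only [Set.ofPred_forall, Set.ofPred_and]
  exact (isClosed_iInter fun i => isClosed_iInter fun j => isClosed_iInter fun k =>
    (isClosed_eq (by fun_prop) (by fun_prop)).inter (isClosed_eq (by fun_prop) (by fun_prop))).inter
    (isClosed_iInter fun i => isClosed_eq (by fun_prop) (by fun_prop))

lemma mem_displacements_iff (w : Fin d → L2per C) (G : Fin d → Fin d → L2per C) :
    ((fun i => toTorusL2 C (w i), fun i j => toTorusL2 C (G i j)) :
      (Fin d → TorusL2 d) × (Fin d → Fin d → TorusL2 d)) ∈ displacements C ↔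
    IsH1Gradient w G ∧ ∀ i, avgMul (w i) (cosMode C 0) = 0 := by
  change (∀ i j k, _) ∧ _ ↔ _
  simp only [inner_toTorusL2]
  exact and_congr_left' (forall_congr' fun i => forall_congr' fun j => isWeakPartial_iff.symm)

/-- The strain of a displacement field. -/
def strain (C : UnitCell d) (L : ElasticityTensor d) : displacements C →ₗ[ℝ] He C L where
  toFun p := ofComponents C L (fun i j => (1 / 2 : ℝ) • (p.1.2 i j + p.1.2 j i))
    fun i j => by rw [add_comm]
  map_add' p q := by
    apply He.field.injective
    ext1
    funext i j
    simp [ofComponents]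
    module
  map_smul' c p := by
    apply He.field.injective
    ext1
    funext i j
    simp [ofComponents]
    module

lemma field_strain (L : ElasticityTensor d) (p : displacements C) (i j : Fin d) :
    (strain C L p).field.1 i j =
      (1 / 2 : ℝ) • ((toTorusL2 C).symm (p.1.2 i j) + (toTorusL2 C).symm (p.1.2 j i)) := by
  rw [← map_add, ← map_smul]
  rfl

lemma components_strain (L : ElasticityTensor d) (p : displacements C) :
    components C L (strain C L p) = fun i j => (1 / 2 : ℝ) • (p.1.2 i j + p.1.2 j i) :=
  components_ofComponents L fun i j => by rw [add_comm]

/-- Subtracting its mean from a displacement leaves the gradient unchanged, so the mean-free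
normalization loses no strain. It is needed for Poincaré's inequality, since constants have zero
strain. -/
lemma range_strain (C : UnitCell d) (L : ElasticityTensor d) :
    LinearMap.range (strain C L) = E0 C L := by
  ext e
  constructor
  · rintro ⟨⟨p, hp⟩, rfl⟩
    refine ⟨fun i => (toTorusL2 C).symm (p.1 i), fun i j => (toTorusL2 C).symm (p.2 i j),
      ((mem_displacements_iff _ _).1 ?_).1, fun i j => ?_⟩
    · simpa using hp
    · exact field_strain L _ i j
  · rintro ⟨w, G, hG, he⟩
    have hp := (mem_displacements_iff
      (fun i => w i - avgMul (w i) (cosMode C 0) • cosMode C 0) G).2 ⟨fun i j => ?_, fun i => ?_⟩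
    · refine ⟨⟨_, hp⟩, He.field.injective (Subtype.ext (funext fun i => funext fun j => ?_))⟩
      rw [he, field_strain, LinearEquiv.symm_apply_apply, LinearEquiv.symm_apply_apply]
    · refine isWeakPartial_iff.2 fun k => ?_
      have h1 := isWeakPartial_iff.1 (hG i j) k
      have h2 := isWeakPartial_iff.1 (isWeakPartial_cosMode_zero C j) k
      simp only [map_zero, LinearMap.zero_apply] at h2
      simp only [map_sub, map_smul, LinearMap.sub_apply, LinearMap.smul_apply, smul_eq_mul, h1.1,
        h1.2]
      constructor
      · linear_combination -avgMul (w i) (cosMode C 0) * h2.1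
      · linear_combination -avgMul (w i) (cosMode C 0) * h2.2
    · rw [map_sub, map_smul, LinearMap.sub_apply, LinearMap.smul_apply,
        avgMul_cosMode_zero_self, smul_eq_mul, mul_one, sub_self]

lemma exists_norm_strain_le (C : UnitCell d) (L : ElasticityTensor d) :
    ∃ K : ℝ, 0 ≤ K ∧ ∀ p, ‖strain C L p‖ ≤ K * ‖p‖ := by
  obtain ⟨K, hK, h⟩ := exists_norm_le_components C L
  refine ⟨K, hK, fun p => (h _).trans (mul_le_mul_of_nonneg_left ?_ hK)⟩
  rw [components_strain]
  have h1 : ∀ i j, ‖p.1.2 i j‖ ≤ ‖p‖ := fun i j =>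
    (norm_le_pi_norm (p.1.2 i) j).trans ((norm_le_pi_norm p.1.2 i).trans (norm_snd_le p.1))
  refine (pi_norm_le_iff_of_nonneg (norm_nonneg _)).2 fun i =>
    (pi_norm_le_iff_of_nonneg (norm_nonneg _)).2 fun j => ?_
  rw [norm_smul, Real.norm_of_nonneg (by norm_num)]
  linarith [norm_add_le (p.1.2 i j) (p.1.2 j i), h1 i j, h1 j i]

/-- Korn bounds the gradient by the strain, with the factor 2 and the coercivity constant `c`;
Poincaré then bounds the displacement by the gradient, with the factor `P`. The constant `1 + P`
covers both cases. -/
lemma exists_norm_le_strain (C : UnitCell d) (L : ElasticityTensor d) :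
    ∃ K : ℝ, 0 ≤ K ∧ ∀ p, ‖p‖ ≤ K * ‖strain C L p‖ := by
  obtain ⟨c, hc, h⟩ := exists_duality_le_norm_sq C L
  set P := ∑ i, ‖C.Y i‖ ^ 2 with hP
  have hP0 : 0 ≤ P := by positivity
  refine ⟨Real.sqrt ((1 + P) * (2 * c⁻¹)), Real.sqrt_nonneg _, fun p => ?_⟩
  obtain ⟨⟨wt, Gt⟩, hp⟩ := p
  obtain ⟨w, rfl⟩ : ∃ w : Fin d → L2per C, wt = fun i => toTorusL2 C (w i) :=
    ⟨fun i => (toTorusL2 C).symm (wt i), by simp⟩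
  obtain ⟨G, rfl⟩ : ∃ G : Fin d → Fin d → L2per C, Gt = fun i j => toTorusL2 C (G i j) :=
    ⟨fun i j => (toTorusL2 C).symm (Gt i j), by simp⟩
  obtain ⟨hG, hw⟩ := (mem_displacements_iff w G).1 hp
  set e := strain C L ⟨_, hp⟩ with he
  have hfield : ∀ i j, e.field.1 i j = (1 / 2 : ℝ) • (G i j + G j i) := fun i j => by
    rw [he, field_strain, LinearEquiv.symm_apply_apply, LinearEquiv.symm_apply_apply]
  have hsum : ∑ i, ∑ j, avgMul (G i j) (G i j) ≤ 2 * c⁻¹ * ‖e‖ ^ 2 := by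
    have h1 := h e
    rw [duality_eq_sum, ← le_inv_mul_iff₀ hc] at h1
    simp only [hfield] at h1
    linarith [korn hG]
  have hrow : ∀ i, ∑ j, avgMul (G i j) (G i j) ≤ 2 * c⁻¹ * ‖e‖ ^ 2 := fun i =>
    (Finset.single_le_sum (f := fun i => ∑ j, avgMul (G i j) (G i j))
      (fun i _ => Finset.sum_nonneg fun j _ => avgMul_self_nonneg _) (Finset.mem_univ i)).trans hsum
  have hB : 0 ≤ 2 * c⁻¹ * ‖e‖ ^ 2 := by positivity
  have hR : 0 ≤ Real.sqrt ((1 + P) * (2 * c⁻¹)) * ‖e‖ := by positivity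
  have hfin : ∀ f : L2per C, avgMul f f ≤ (1 + P) * (2 * c⁻¹ * ‖e‖ ^ 2) →
      ‖toTorusL2 C f‖ ≤ Real.sqrt ((1 + P) * (2 * c⁻¹)) * ‖e‖ := fun f hf => by
    refine le_of_sq_le_sq ?_ hR
    rw [mul_pow, Real.sq_sqrt (by positivity), norm_toTorusL2_sq, mul_assoc]
    exact hf
  refine max_le ((pi_norm_le_iff_of_nonneg hR).2 fun i => hfin _ ?_)
    ((pi_norm_le_iff_of_nonneg hR).2 fun i => (pi_norm_le_iff_of_nonneg hR).2 fun j => hfin _ ?_)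
  · have h1 := (poincare (hG i) (hw i)).trans (mul_le_mul_of_nonneg_left (hrow i) hP0)
    linarith
  · have h1 := (Finset.single_le_sum (f := fun j => avgMul (G i j) (G i j))
      (fun j _ => avgMul_self_nonneg _) (Finset.mem_univ j)).trans (hrow i)
    have h2 := mul_nonneg hP0 hB
    linarith

/-- It is the image of a complete space under a continuous linear map that is bounded below. -/
lemma isClosed_E0 (C : UnitCell d) (L : ElasticityTensor d) : IsClosed (E0 C L : Set (He C L)) := by
  obtain ⟨h1, K, h2⟩ := uniformContinuous_antilipschitz_of_bounds (strain C L)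
    (exists_norm_strain_le C L) (exists_norm_le_strain C L)
  have : CompleteSpace (displacements C) := (isClosed_displacements C).completeSpace_coe
  rw [← range_strain, LinearMap.coe_range]
  exact h2.isClosed_range h1

/-! ### Admissible stresses as the annihilator of compatible strains -/

lemma duality_sym (s : SymL2per C) {η : SymL2per C} {G : Fin d → Fin d → L2per C}
    (hη : ∀ i j, η.1 i j = (1 / 2 : ℝ) • (G i j + G j i)) :
    duality s η = ∑ i, ∑ j, avgMul (s.1 i j) (G i j) := by
  have h1 : ∑ i, ∑ j, avgMul (s.1 i j) (G j i) = ∑ i, ∑ j, avgMul (s.1 i j) (G i j) := by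
    rw [Finset.sum_comm]
    exact Finset.sum_congr rfl fun i _ => Finset.sum_congr rfl fun j _ => by rw [s.2 j i]
  simp only [duality_eq_sum, hη, map_smul, map_add, smul_eq_mul, ← Finset.mul_sum,
    Finset.sum_add_distrib, h1]
  ring

lemma isWeakDiv_zero_iff {f : Fin d → L2per C} :
    IsWeakDiv f 0 ↔ ∀ φ : X d → ℝ, IsTest φ → ∑ j, ∫ x, fn (f j) x * pderiv j φ x = 0 := by
  simp only [IsWeakDiv, integral_zero_mul, neg_zero]

lemma IsWeakDiv.add {f g : Fin d → L2per C} (hf : IsWeakDiv f 0) (hg : IsWeakDiv g 0) :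
    IsWeakDiv (f + g) 0 := by
  rw [isWeakDiv_zero_iff] at *
  intro φ hφ
  simp only [Pi.add_apply]
  rw [← add_zero (0 : ℝ)]
  nth_rewrite 1 [← hf φ hφ]
  rw [← hg φ hφ, ← Finset.sum_add_distrib]
  exact Finset.sum_congr rfl fun j _ =>
    integral_add_mul (integrable_mul_pderiv _ hφ j) (integrable_mul_pderiv _ hφ j)

lemma isWeakDiv_of_ae_const {f : Fin d → L2per C} {c : Fin d → ℝ}
    (hf : ∀ j, fn (f j) =ᵐ[volume] fun _ => c j) : IsWeakDiv f 0 := by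
  refine isWeakDiv_zero_iff.2 fun φ hφ => Finset.sum_eq_zero fun j _ => ?_
  rw [← mul_zero (c j), ← integral_pderiv hφ j, ← integral_const_mul]
  refine integral_congr_ae ?_
  filter_upwards [hf j] with x hx
  rw [hx]

lemma isWeakDiv_of_mem_S {s : Hs C} (hs : s ∈ S C) (i : Fin d) : IsWeakDiv (s.1 i) 0 := by
  obtain ⟨c, ⟨m, hm⟩, t, ht, rfl⟩ := Submodule.mem_sup.1 hs
  exact (isWeakDiv_of_ae_const (hm i)).add
    (isWeakDiv_zero_iff.2 fun φ hφ => ht.1 φ hφ i)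

/-- A stress field whose rows are divergence free is statically admissible. -/
lemma mem_S_of_isWeakDiv {s : Hs C} (hs : ∀ i, IsWeakDiv (s.1 i) 0) : s ∈ S C := by
  -- The uniform part is the mean of `s`; subtracting it preserves the vanishing divergence and
  -- leaves a mean-free remainder.
  let c : Hs C := ⟨fun i j => avgMul (s.1 i j) (cosMode C 0) • cosMode C 0,
    fun i j => by beta_reduce; rw [s.2 i j]⟩
  have hc : ∀ (t : ℝ) (i j : Fin d), fn (t • c.1 i j) =ᵐ[volume]
      fun _ => t * avgMul (s.1 i j) (cosMode C 0) := fun t i j => by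
    filter_upwards [fn_smul t (c.1 i j), fn_smul (avgMul (s.1 i j) (cosMode C 0)) (cosMode C 0),
      fn_cosMode_zero C] with x h1 h2 h3
    rw [h1]
    change t * fn (avgMul (s.1 i j) (cosMode C 0) • cosMode C 0) x = _
    rw [h2, h3, mul_one]
  refine Submodule.mem_sup.2 ⟨c, ⟨fun i j => avgMul (s.1 i j) (cosMode C 0), fun i j => ?_⟩,
    s - c, ⟨?_, fun i j => ?_⟩, (add_comm _ _).trans (sub_add_cancel s c)⟩
  · have h1 := hc 1 i j
    rwa [one_smul, one_mul] at h1
  · intro φ hφ i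
    have h1 : (s - c).1 i = s.1 i + fun j => (-1 : ℝ) • c.1 i j := by
      funext j
      exact (sub_eq_add_neg (s.1 i j) (c.1 i j)).trans
        (congrArg (s.1 i j + ·) (neg_one_smul ℝ (c.1 i j)).symm)
    have h2 := (hs i).add (isWeakDiv_of_ae_const (hc (-1) i))
    rw [← h1] at h2
    exact isWeakDiv_zero_iff.1 h2 φ hφ
  · change cellAverage C (fn ((s - c).1 i j)) = 0
    rw [← avgMul_cosMode_zero]
    change avgMul (s.1 i j - avgMul (s.1 i j) (cosMode C 0) • cosMode C 0) _ = 0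
    rw [map_sub, map_smul, LinearMap.sub_apply, LinearMap.smul_apply, avgMul_cosMode_zero_self,
      smul_eq_mul, mul_one, sub_self]

/-- Symmetry of the stress replaces the strain by the full gradient; each row of the stress is
divergence free, so integration by parts against one displacement component gives zero. -/
lemma duality_eq_zero_of_mem {L : ElasticityTensor d} {s : Hs C} (hs : s ∈ S C) {e : He C L}
    (he : e ∈ E0 C L) : duality s e.field = 0 := by
  obtain ⟨w, G, hG, he⟩ := he
  rw [duality_sym s he]
  refine Finset.sum_eq_zero fun i _ => ?_
  rw [(isWeakDiv_of_mem_S hs i).isFourierDiv.sum_avgMul fun j => isWeakPartial_iff.1 (hG i j),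
    map_zero, LinearMap.zero_apply, neg_zero]

/-- The statically admissible stress fields are the annihilator of the compatible strain fields. -/
lemma mem_S_iff (L : ElasticityTensor d) {s : Hs C} :
    s ∈ S C ↔ ∀ e ∈ E0 C L, duality s e.field = 0 := by
  refine ⟨fun hs e he => duality_eq_zero_of_mem hs he, fun h => mem_S_of_isWeakDiv fun i =>
    isWeakDiv_zero_iff.2 fun φ hφ => ?_⟩
  obtain ⟨Φ, hΦ⟩ := exists_periodization C hφ.1.continuous hφ.2
  choose Ψ hΨ using fun j => exists_periodization C (continuous_pderiv hφ.1 j)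
    (hφ.hasCompactSupport_pderiv j)
  -- The displacement has the periodization of `φ` as its only nonzero component, in position `i`.
  -- Its duality product with `s` is row `i` of the divergence of `s` tested on `φ`, up to sign.
  let G : Fin d → Fin d → L2per C := Pi.single i Ψ
  have hG : IsH1Gradient (Pi.single i Φ) G := by
    intro i' j
    rcases eq_or_ne i' i with rfl | hi
    · simp only [G, Pi.single_eq_same]
      exact isWeakPartial_iff.2 (isFourierPartial_periodization hφ j hΦ (hΨ j))
    · simp only [G, Pi.single_eq_of_ne hi]
      intro φ _
      simp [integral_zero_mul]
  let η : SymL2per C := ⟨fun i j => (1 / 2 : ℝ) • (G i j + G j i),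
    fun i j => by beta_reduce; rw [add_comm]⟩
  have h1 := h (He.field.symm η) ⟨_, G, hG, fun i j => rfl⟩
  rw [LinearEquiv.apply_symm_apply, duality_sym s (G := G) fun i j => rfl,
    Finset.sum_eq_single i] at h1
  · simpa [G, hΨ] using h1
  · intro i' _ hi
    exact Finset.sum_eq_zero fun j _ => by simp [G, Pi.single_eq_of_ne hi]
  · simp

/-! ### The Eshelby problem and its Green operator -/

lemma duality_sub_left (s t η : SymL2per C) : duality (s - t) η = duality s η - duality t η := by
  simp [duality_eq_sum]

/-- The weak form of the Eshelby problem. -/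
lemma solvesEshelby_iff {L : ElasticityTensor d} {τ : Hs C} {e : He C L} :
    SolvesEshelby L τ e ↔
      e ∈ E0 C L ∧ ∀ ε ∈ E0 C L, inner ℝ e ε = duality τ ε.field := by
  refine and_congr_right' ((mem_S_iff L).trans (forall₂_congr fun ε _ => ?_))
  rw [duality_sub_left, sub_eq_zero]
  rfl

lemma abs_duality_le (s η : SymL2per C) : |duality s η| ≤ duality η η + duality s s := by
  simp only [duality_eq_sum, ← Finset.sum_add_distrib]
  refine (Finset.abs_sum_le_sum_abs _ _).trans (Finset.sum_le_sum fun i _ =>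
    (Finset.abs_sum_le_sum_abs _ _).trans (Finset.sum_le_sum fun j _ => ?_))
  rw [← inner_toTorusL2, ← norm_toTorusL2_sq, ← norm_toTorusL2_sq]
  refine (abs_real_inner_le_norm _ _).trans ?_
  nlinarith [sq_nonneg (‖toTorusL2 C (s.1 i j)‖ - ‖toTorusL2 C (η.1 i j)‖),
    sq_nonneg (‖toTorusL2 C (s.1 i j)‖), sq_nonneg (‖toTorusL2 C (η.1 i j)‖)]

/-- Riesz representation in the energetic product plays the role of applying the inverse stiffness
to `τ`, without inverting the tensor. -/
lemma exists_inner_eq_duality (L : ElasticityTensor d) (τ : Hs C) :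
    ∃ ξ : He C L, ∀ η : He C L, inner ℝ ξ η = duality τ η.field := by
  have := completeSpace_he C L
  obtain ⟨c, hc, h⟩ := exists_duality_le_norm_sq C L
  let l : He C L →ₗ[ℝ] ℝ :=
    { toFun := fun η => duality τ η.field
      map_add' := fun η ζ => by simp [duality_eq_sum, Finset.sum_add_distrib]
      map_smul' := fun a η => by simp [duality_eq_sum, Finset.mul_sum] }
  have hl : ∀ η, ‖l η‖ ≤ (c⁻¹ + duality τ τ) * ‖η‖ := abs_le_of_quadratic_growth l fun η => by
    refine (abs_duality_le τ η.field).trans (add_le_add_left ?_ _)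
    rw [le_inv_mul_iff₀ hc]
    exact h η
  exact ⟨(InnerProductSpace.toDual ℝ _).symm (l.mkContinuous _ hl),
    fun η => InnerProductSpace.toDual_symm_apply⟩

/-- The difference of two solutions is compatible and orthogonal to every compatible strain, hence
to itself. -/
lemma SolvesEshelby.unique {L : ElasticityTensor d} {τ : Hs C} {e e' : He C L}
    (h : SolvesEshelby L τ e) (h' : SolvesEshelby L τ e') : e = e' := by
  rw [solvesEshelby_iff] at h h'
  have h1 := (E0 C L).sub_mem h.1 h'.1
  rw [← sub_eq_zero, ← inner_self_eq_zero (𝕜 := ℝ)]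
  nth_rewrite 1 [inner_sub_left]
  rw [h.2 _ h1, h'.2 _ h1, sub_self]

lemma hasOrthogonalProjection_E0 (C : UnitCell d) (L : ElasticityTensor d) :
    (E0 C L).HasOrthogonalProjection := by
  have := completeSpace_he C L
  have : CompleteSpace (E0 C L) := (isClosed_E0 C L).completeSpace_coe
  infer_instance

/-- The orthogonal projection of a representer of the data solves the Eshelby problem. -/
lemma solvesEshelby_starProjection {L : ElasticityTensor d} [(E0 C L).HasOrthogonalProjection]
    {τ : Hs C} {ξ : He C L} (hξ : ∀ η : He C L, inner ℝ ξ η = duality τ η.field) :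
    SolvesEshelby L τ ((E0 C L).starProjection ξ) := by
  refine solvesEshelby_iff.2 ⟨Submodule.starProjection_apply_mem _ _, fun ε hε => ?_⟩
  rw [← hξ, Submodule.inner_starProjection_left_eq_right,
    Submodule.starProjection_eq_self_iff.2 hε]

lemma solvesEshelby_green (L : ElasticityTensor d) (τ : Hs C) :
    SolvesEshelby L τ (Green L τ) := by
  have := hasOrthogonalProjection_E0 C L
  obtain ⟨ξ, hξ⟩ := exists_inner_eq_duality L τ
  have h : ∃ e : He C L, SolvesEshelby L τ e := ⟨_, solvesEshelby_starProjection hξ⟩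
  rw [Green, dif_pos h]
  exact h.choose_spec

/-- For data of this form the representer is `η` itself, by the definition of the energetic product,
so uniqueness identifies the solution with the projection of `η`. -/
lemma green_stiffness {L : ElasticityTensor d} [(E0 C L).HasOrthogonalProjection] (η : He C L) :
    Green L (stiffness L η) = (E0 C L).starProjection η :=
  (solvesEshelby_green L _).unique (solvesEshelby_starProjection fun _ => rfl)

end PeriodicElasticity

end

theorem lemma2p2 {d : ℕ} (C : UnitCell d) (L₀ : ElasticityTensor d) :
    -- `H_e` is a Hilbert space, and the Eshelby problem defining `Γ₀` is well posed
    CompleteSpace (He C L₀) ∧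
    (∀ (τ : Hs C) (e : He C L₀), SolvesEshelby L₀ τ e ↔ e = Green L₀ τ) ∧
    -- idempotence
    (∀ η : He C L₀,
      Green L₀ (stiffness L₀ (Green L₀ (stiffness L₀ η))) = Green L₀ (stiffness L₀ η)) ∧
    -- self-adjointness for the energetic scalar product
    (∀ η ζ : He C L₀,
      inner ℝ η (Green L₀ (stiffness L₀ ζ)) = inner ℝ (Green L₀ (stiffness L₀ η)) ζ) ∧
    -- values in `E_0`, and identity on `E_0`
    (∀ η : He C L₀, Green L₀ (stiffness L₀ η) ∈ E0 C L₀) ∧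
    (∀ e ∈ E0 C L₀, Green L₀ (stiffness L₀ e) = e) ∧
    -- `Γ₀ L₀` is the orthogonal projector onto `E_0`
    (∃ _ : (E0 C L₀).HasOrthogonalProjection,
      ∀ η : He C L₀, Green L₀ (stiffness L₀ η) = (E0 C L₀).starProjection η) := by
  have := hasOrthogonalProjection_E0 C L₀
  refine ⟨completeSpace_he C L₀, fun τ e => ⟨fun h => h.unique (solvesEshelby_green L₀ τ), ?_⟩,
    fun η => ?_, fun η ζ => ?_, fun η => ?_, fun e he => ?_, this, green_stiffness⟩
  · rintro rfl
    exact solvesEshelby_green L₀ τ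
  · simp only [green_stiffness]
    exact Submodule.starProjection_eq_self_iff.2 (Submodule.starProjection_apply_mem _ _)
  · rw [green_stiffness, green_stiffness, Submodule.inner_starProjection_left_eq_right]
  · exact (solvesEshelby_green L₀ _).1
  · rw [green_stiffness]
    exact Submodule.starProjection_eq_self_iff.2 he
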